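/- Let $K$ be a field of characteristic $0$, $\mathfrak g$ a finite-dimensional Lie algebra over $K$ with non-degenerate Killing form, $\mathfrak h\subset\mathfrak g$ a splitting Cartan subalgebra and $\Lambda$ the set of roots. For a root $\alpha$ let $H_\alpha\in\mathfrak h$ be half of its coroot, so that $\alpha(H_\alpha)=1$. Let $\lambda_0,\lambda_0^\perp,\lambda'\in\Lambda$ be roots such that - $\lambda'$ is a constituent root of $\lambda_0^\perp$: $\lambda_0^\perp-\lambda'\in\Lambda$, while $\lambda'+\lambda_0^\perp\notin\Lambda$ and $(\lambda_0^\perp-\lambda')+\lambda_0^\perp\notin\Lambda$; - $\lambda'$ coincides with $\widetilde{\lambda'}:=-\lambda'-\lambda_0+\lambda_0^\perp$; - the $\lambda_0$-series of $\lambda'$ is short: $\lambda'+2\lambda_0\notin\Lambda$. Then $\lambda'+\lambda_0=\lambda_0^\perp-\lambda'$ and the long series $\lambda_0^\perp,\ \lambda_0^\perp-\lambda',\ \lambda_0^\perp-2\lambda'$ consists of roots. There are non-zero root vectors $L_{\lambda_0}$, $L_{\lambda_0^\perp}$, $L_{\lambda'}$, $L_{\lambda_0^\perp-\lambda'}$ with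 the normalization $[L_{\lambda'},L_{\lambda_0^\perp-\lambda'}]=L_{\lambda_0^\perp}$ and $[L_{\lambda'},L_{\lambda_0}]=-L_{\lambda_0^\perp-\lambda'}$. For all root vectors so normalized, work in $U(\mathfrak g)[[h]]$ and its completed tensor powers, with the standard coproduct $\Delta$ and counit $\varepsilon$ of $U(\mathfrak g)$. Put $H=H_{\lambda_0}$, $A=L_{\lambda'}$, $B=hL_{\lambda_0^\perp-\lambda'}$, $P=hL_{\lambda_0^\perp}$, $E=hL_{\lambda_0}$ (the rescaled vectors again satisfy $[A,B]=P$, $[A,E]=-B$), $\sigma_0^\perp=\ln(1+P)$, and $$E_{\mathcal{BO}}=E+\tfrac12B^2e^{-\sigma_0^\perp},\qquad \Phi_{\mathcal J_\perp}=\exp(H_{\lambda_0^\perp}\otimes\sigma_0^\perp),\qquad \Phi_{\mathcal E_\perp}=\exp\bigl(A\otimes Be^{-\frac12\sigma_0^\perp}\bigr),\qquad \Phi_{\mathcal{BJ}}=\exp\bigl(H\otimes\ln(1+E_{\mathcal{BO}})\bigr).$$ Call $\mathcal F\in(U(\mathfrak g)\otimes U(\mathfrak g))[[h]]$ a twisting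 element if it is invertible, $\mathcal F\equiv1$ modulo $h$, $\mathcal F_{12}(\Delta\otimes\mathrm{id})\mathcal F=\mathcal F_{23}(\mathrm{id}\otimes\Delta)\mathcal F$ and $(\varepsilon\otimes\mathrm{id})\mathcal F=(\mathrm{id}\otimes\varepsilon)\mathcal F=1$. Then 1. $\mathcal F=\Phi_{\mathcal E_\perp}\Phi_{\mathcal J_\perp}$ is a twisting element; 2. $[H,E_{\mathcal{BO}}]=E_{\mathcal{BO}}$, and both $H$ and $E_{\mathcal{BO}}$ are primitive for the twisted coproduct $\Delta_{\mathcal F}(x)=\mathcal F\,\Delta(x)\,\mathcal F^{-1}$, that is, $\Delta_{\mathcal F}(x)=x\otimes1+1\otimes x$ for $x=H$ and $x=E_{\mathcal{BO}}$; 3. $\Phi_{\mathcal{BJ}}\Phi_{\mathcal E_\perp}\Phi_{\mathcal J_\perp}$ is a twisting element. Moreover, if the root system of $(\mathfrak g,\mathfrak h)$ is of type $B_N$ or $C_N$ with $N\ge2$, or of type $F_4$, then roots $\lambda_0,\lambda_0^\perp,\lambda'$ as above exist. -/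

import Mathlib

open scoped TensorProduct PowerSeries

noncomputable section

namespace JordanianTwist

/-! ### Formal power series with coefficients in a (noncommutative) algebra -/

section Series

variable {K : Type*} [Field K] [CharZero K]
variable {A : Type*} [Ring A] [Algebra K A]

/-- The series `∑ₖ cₖ aᵏ` in `A⟦X⟧`, for a scalar series `c = ∑ₖ cₖ Xᵏ` and a series `a` without
constant term (so that only the terms `k ≤ n` contribute to the coefficient of `Xⁿ`). -/
def evalSeries (c : K⟦X⟧) (a : A⟦X⟧) : A⟦X⟧ :=
  PowerSeries.mk fun n =>
    ∑ k ∈ Finset.range (n + 1), PowerSeries.coeff k c • PowerSeries.coeff n (a ^ k)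

variable (K)

/-- `exp a`, for a series `a` without constant term. -/
def fexp (a : A⟦X⟧) : A⟦X⟧ := evalSeries (PowerSeries.exp K) a

/-- `ln (1 + a)`, for a series `a` without constant term. -/
def flog (a : A⟦X⟧) : A⟦X⟧ := evalSeries (PowerSeries.log K) a

variable (A) in
/-- The completed tensor product `a ⊗ b ∈ (A ⊗ A)⟦X⟧` of two series `a, b ∈ A⟦X⟧`. -/
def tens (a b : A⟦X⟧) : (A ⊗[K] A)⟦X⟧ :=
  PowerSeries.map (Algebra.TensorProduct.includeLeft : A →ₐ[K] A ⊗[K] A).toRingHom a *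
    PowerSeries.map (Algebra.TensorProduct.includeRight : A →ₐ[K] A ⊗[K] A).toRingHom b

end Series

/-! ### The Hopf structure of the universal enveloping algebra, and twists of it -/

section Hopf

variable (K : Type*) [Field K] (L : Type*) [LieRing L] [LieAlgebra K L]

/-- The universal enveloping algebra. -/
abbrev U : Type _ := UniversalEnvelopingAlgebra K L

attribute [local instance 100] LieRing.ofAssociativeRing

/-- The coproduct of the universal enveloping algebra: `Δ x = x ⊗ 1 + 1 ⊗ x` for `x` in the
Lie algebra. -/
def comul : U K L →ₐ[K] U K L ⊗[K] U K L :=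
  UniversalEnvelopingAlgebra.lift K
    { toFun := fun x => UniversalEnvelopingAlgebra.ι K x ⊗ₜ[K] (1 : U K L) +
        (1 : U K L) ⊗ₜ[K] UniversalEnvelopingAlgebra.ι K x
      map_add' := fun x y => by
        simp only [map_add, TensorProduct.add_tmul, TensorProduct.tmul_add]; abel
      map_smul' := fun c x => by
        simp only [map_smul, TensorProduct.smul_tmul', TensorProduct.tmul_smul, smul_add,
          RingHom.id_apply]
      map_lie' := fun {x y} => by
        simp only [LieHom.map_lie, LieRing.of_associative_ring_bracket, TensorProduct.sub_tmul,
          TensorProduct.tmul_sub, mul_add, add_mul, Algebra.TensorProduct.tmul_mul_tmul,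
          mul_one, one_mul]
        abel }

/-- The counit of the universal enveloping algebra: it vanishes on the Lie algebra. -/
def counit : U K L →ₐ[K] K := UniversalEnvelopingAlgebra.lift K (0 : L →ₗ⁅K⁆ K)

/-- The algebra `U(L)[[h]]` of formal power series over the enveloping algebra. -/
abbrev Uh : Type _ := (U K L)⟦X⟧

/-- The completed tensor square of `U(L)[[h]]`. -/
abbrev Uh2 : Type _ := (U K L ⊗[K] U K L)⟦X⟧

/-- The completed tensor cube of `U(L)[[h]]`. -/
abbrev Uh3 : Type _ := ((U K L ⊗[K] U K L) ⊗[K] U K L)⟦X⟧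

variable {K L}

/-- The coproduct extended to `U(L)[[h]]`. -/
def comulh (x : Uh K L) : Uh2 K L := PowerSeries.map (comul K L).toRingHom x

/-- `F₁₂ = F ⊗ 1`. -/
def leg12 (F : Uh2 K L) : Uh3 K L :=
  PowerSeries.map (Algebra.TensorProduct.includeLeft :
    U K L ⊗[K] U K L →ₐ[K] (U K L ⊗[K] U K L) ⊗[K] U K L).toRingHom F

/-- `F₂₃ = 1 ⊗ F`. -/
def leg23 (F : Uh2 K L) : Uh3 K L :=
  PowerSeries.map (((Algebra.TensorProduct.assoc K K K (U K L) (U K L) (U K L)).symm.toAlgHom.comp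
    (Algebra.TensorProduct.includeRight :
      U K L ⊗[K] U K L →ₐ[K] U K L ⊗[K] (U K L ⊗[K] U K L)))).toRingHom F

/-- `(Δ ⊗ id) F`. -/
def comulLeft (F : Uh2 K L) : Uh3 K L :=
  PowerSeries.map (Algebra.TensorProduct.map (comul K L) (AlgHom.id K (U K L))).toRingHom F

/-- `(id ⊗ Δ) F`. -/
def comulRight (F : Uh2 K L) : Uh3 K L :=
  PowerSeries.map (((Algebra.TensorProduct.assoc K K K (U K L) (U K L) (U K L)).symm.toAlgHom.comp
    (Algebra.TensorProduct.map (AlgHom.id K (U K L)) (comul K L)))).toRingHom F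

/-- `(ε ⊗ id) F`. -/
def counitLeft (F : Uh2 K L) : Uh K L :=
  PowerSeries.map (((Algebra.TensorProduct.lid K (U K L)).toAlgHom.comp
    (Algebra.TensorProduct.map (counit K L) (AlgHom.id K (U K L))))).toRingHom F

/-- `(id ⊗ ε) F`. -/
def counitRight (F : Uh2 K L) : Uh K L :=
  PowerSeries.map (((Algebra.TensorProduct.rid K K (U K L)).toAlgHom.comp
    (Algebra.TensorProduct.map (AlgHom.id K (U K L)) (counit K L)))).toRingHom F

/-- `F` is a twisting element for `U(L)[[h]]`: an invertible element, equal to `1` modulo `h`,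
with `F₁₂ (Δ ⊗ id) F = F₂₃ (id ⊗ Δ) F` and `(ε ⊗ id) F = (id ⊗ ε) F = 1`. -/
structure IsTwist (F : Uh2 K L) : Prop where
  isUnit : IsUnit F
  constantCoeff : PowerSeries.constantCoeff F = 1
  cocycle : leg12 F * comulLeft F = leg23 F * comulRight F
  counit_left : counitLeft F = 1
  counit_right : counitRight F = 1

/-- The twisted coproduct `Δ_F x = F (Δ x) F⁻¹`. -/
def twistedComul (F : Uh2 K L) (x : Uh K L) : Uh2 K L := F * comulh x * Ring.inverse F

/-- `x` is primitive for the coproduct twisted by `F`: `Δ_F x = x ⊗ 1 + 1 ⊗ x`. -/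
def IsPrimitiveFor (F : Uh2 K L) (x : Uh K L) : Prop :=
  twistedComul F x = tens K (U K L) x 1 + tens K (U K L) 1 x

variable (K)

/-- An element of the Lie algebra as an element of `U(L)[[h]]`. -/
def gen (x : L) : Uh K L := PowerSeries.C (UniversalEnvelopingAlgebra.ι K x)

/-- The rescaled element `h x` of `U(L)[[h]]`. -/
def hgen (x : L) : Uh K L := PowerSeries.X * gen K x

end Hopf

/-! ### The twisting factors and the deformed element -/

section Factors

variable {K : Type*} [Field K] [CharZero K] {L : Type*} [LieRing L] [LieAlgebra K L]

/-- The Jordanian factor `exp (T ⊗ ln (1 + P))`. -/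
def jordanian (T P : Uh K L) : Uh2 K L := fexp K (tens K (U K L) T (flog K P))

/-- The extension factor `exp (A ⊗ B e^{-σ/2})`, where `σ = ln (1 + P)`. -/
def extensionFactor (A B P : Uh K L) : Uh2 K L :=
  fexp K (tens K (U K L) A (B * fexp K (-((2⁻¹ : K) • flog K P))))

/-- The deformed element `E + ½ B² e^{-σ}`, where `σ = ln (1 + P)`. -/
def deformed (E B P : Uh K L) : Uh K L := E + (2⁻¹ : K) • (B ^ 2 * fexp K (-flog K P))

end Factors

/-! ### Roots -/

section Roots

open LieAlgebra LieAlgebra.IsKilling LieModule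

variable {K : Type*} [Field K] [CharZero K] {L : Type*} [LieRing L] [LieAlgebra K L]
  [FiniteDimensional K L] [IsKilling K L]
  (H : LieSubalgebra K L) [H.IsCartanSubalgebra] [IsTriangularizable K H L]

/-- `χ` is a root of `L` with respect to `H`. -/
def IsRoot (χ : H → K) : Prop := ∃ γ : Weight K H L, γ.IsNonZero ∧ (γ : H → K) = χ

variable {H}

/-- The Cartan generator dual to the root `α`, normalized by `α (H_α) = 1`: half the coroot. -/
def cartanGen (α : Weight K H L) : L := (2⁻¹ : K) • ((coroot α : H) : L)

/-- `μ` is a constituent root of `θ`: both `μ` and `θ - μ` are roots, and neither of them can be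
shifted by `θ`. -/
structure IsConstituent (θ μ : Weight K H L) : Prop where
  root : IsRoot H μ
  root_sub : IsRoot H (θ - μ)
  not_root_add : ¬ IsRoot H (μ + θ)
  not_root_sub_add : ¬ IsRoot H (θ - μ + θ)

/-- The configuration of roots `λ₀ = lam`, `λ₀^⊥ = θ`, `λ' = μ` of the special case: `μ` is a
constituent root of `θ`, it coincides with its partner `-μ - lam + θ`, and the `lam`-series
`μ, μ + lam` is short. -/
structure IsCoincidentTriple (lam θ μ : Weight K H L) : Prop where
  lam_root : IsRoot H lam
  θ_root : IsRoot H θ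
  constituent : IsConstituent θ μ
  coincide : (μ : H → K) = -μ - lam + θ
  short : ¬ IsRoot H (μ + 2 • (lam : H → K))

/-- Root vectors `E = L_{λ₀}`, `P = L_{λ₀^⊥}`, `A = L_{λ'}`, `B = L_{λ₀^⊥ - λ'}` with the
normalization `[A, B] = P`, `[A, E] = -B` of the structure constants. -/
structure IsNormalized (lam θ μ : Weight K H L) (E P A B : L) : Prop where
  E_mem : E ∈ rootSpace H lam
  P_mem : P ∈ rootSpace H θ
  A_mem : A ∈ rootSpace H μ
  B_mem : B ∈ rootSpace H (θ - μ : H → K)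
  E_ne : E ≠ 0
  P_ne : P ≠ 0
  A_ne : A ≠ 0
  B_ne : B ≠ 0
  lie_A_B : ⁅A, B⁆ = P
  lie_A_E : ⁅A, E⁆ = -B

variable (H)

/-- The root system of `L` with respect to `H` has the Cartan matrix `M`. -/
def HasCartanMatrix {n : ℕ} (M : Matrix (Fin n) (Fin n) ℤ) : Prop :=
  ∃ (b : (rootSystem H).Base) (e : b.support ≃ Fin n), ∀ i j, b.cartanMatrix i j = M (e i) (e j)

end Roots

end JordanianTwist

end

/-! Coincidence says `θ = lam + 2μ`. With the finite list of possible pairs of Cartan integers, the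
other hypotheses leave only `lam (coroot μ) = -2`, `μ (coroot lam) = -1`
(`IsCoincidentTriple.isLongShort`). So `lam`, `lam + μ`, `lam + 2μ = θ` is a root string in a `C₂`,
along which `ad A` sends `E` to `-B`, `B` to `P` and `P` to `0`. Every other bracket of `E`, `B`,
`P` vanishes, because no weight takes the value `4` on a coroot. Conversely, a double edge of the
Dynkin diagram produces such a triple.

On the Hopf side, suppose `F` is a twist that conjugates `Δ a`, `Δ b` into `a'`, `b'`. Then the
cocycle equation of `exp (a ⊗ b) F` reduces to an identity between four exponentials in the tensor
cube (`IsTwist.fexp_mul`). It holds for a primitive Borel pair (`IsTwist.jordanian_mul`) and for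
quasi-primitive `a`, `b` (`IsTwist.extension_mul`); these give `Φ_J` and `Φ_E Φ_J`.

Put `b' = B e^{-σ/2}`. Under `Φ_E Φ_J` the coproduct of `E` acquires the defect `-B ⊗ b' - ½ P ⊗
b'²`, while `b'` becomes quasi-primitive with `Δ b' = b' ⊗ 1 + e^{σ/2} ⊗ b'`. The cross terms of `½
(Δ b')²` cancel the defect, since `e^σ = 1 + P`. Hence `E + ½ b'²` is primitive, and it has weight
one under the primitive element `H`; a second use of `IsTwist.jordanian_mul` yields the composite
twist. -/

open scoped TensorProduct PowerSeries

noncomputable section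

namespace JordanianTwist

/-! ### Functional calculus for series without constant term: `exp`, `log`, commutators. -/

section Series

variable {K : Type*} [Field K]
variable {A : Type*} [Ring A] [Algebra K A]

theorem coeff_pow_eq_zero {a : A⟦X⟧} (ha : PowerSeries.constantCoeff a = 0) {n k : ℕ}
    (h : n < k) : PowerSeries.coeff n (a ^ k) = 0 := by
  obtain ⟨w, rfl⟩ := PowerSeries.X_dvd_iff.2 ha
  rw [((PowerSeries.commute_X w).symm).mul_pow, PowerSeries.coeff_X_pow_mul', if_neg (by omega)]

theorem coeff_mul_congr {x x' y y' : A⟦X⟧} {n : ℕ}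
    (hx : ∀ m ≤ n, PowerSeries.coeff m x = PowerSeries.coeff m x')
    (hy : ∀ m ≤ n, PowerSeries.coeff m y = PowerSeries.coeff m y') :
    PowerSeries.coeff n (x * y) = PowerSeries.coeff n (x' * y') := by
  rw [PowerSeries.coeff_mul, PowerSeries.coeff_mul]
  refine Finset.sum_congr rfl fun p hp => ?_
  rw [Finset.HasAntidiagonal.mem_antidiagonal] at hp
  rw [hx _ (by omega), hy _ (by omega)]

/-- The cutoff `N` is free above `n`, so several series can be compared with one common cutoff. -/
theorem coeff_evalSeries (c : K⟦X⟧) {a : A⟦X⟧} (ha : PowerSeries.constantCoeff a = 0) {n N : ℕ}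
    (h : n < N) : PowerSeries.coeff n (evalSeries c a) =
      PowerSeries.coeff n (∑ k ∈ Finset.range N, PowerSeries.coeff k c • a ^ k) := by
  rw [evalSeries, PowerSeries.coeff_mk, map_sum]
  simp only [PowerSeries.coeff_smul]
  refine Finset.sum_subset (by simpa using h) fun k _ hk => ?_
  rw [coeff_pow_eq_zero ha (by simpa using hk), smul_zero]

theorem evalSeries_coe (p : Polynomial K) {a : A⟦X⟧} (ha : PowerSeries.constantCoeff a = 0) :
    evalSeries (p : K⟦X⟧) a = Polynomial.aeval a p := by
  ext n
  rw [coeff_evalSeries _ ha (N := max (n + 1) (p.natDegree + 1)) (by omega),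
    Polynomial.aeval_eq_sum_range' (n := max (n + 1) (p.natDegree + 1)) (by omega)]
  simp

theorem coeff_evalSeries_congr {c d : K⟦X⟧} (a : A⟦X⟧) {n : ℕ}
    (h : ∀ k ≤ n, PowerSeries.coeff k c = PowerSeries.coeff k d) :
    PowerSeries.coeff n (evalSeries c a) = PowerSeries.coeff n (evalSeries d a) := by
  simp only [evalSeries, PowerSeries.coeff_mk]
  refine Finset.sum_congr rfl fun k hk => ?_
  rw [h k (by simpa [Nat.lt_succ_iff] using hk)]

/-- Reduces identities for power series, one coefficient at a time, to identities for polynomials in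
`a`. -/
theorem coeff_evalSeries_trunc (c : K⟦X⟧) {a : A⟦X⟧} (ha : PowerSeries.constantCoeff a = 0)
    {n N : ℕ} (h : n < N) : PowerSeries.coeff n (evalSeries c a) =
      PowerSeries.coeff n (Polynomial.aeval a (PowerSeries.trunc N c)) := by
  rw [← evalSeries_coe _ ha]
  refine coeff_evalSeries_congr a fun k hk => ?_
  rw [PowerSeries.coeff_coe_trunc_of_lt (by omega)]

theorem evalSeries_add (c d : K⟦X⟧) (a : A⟦X⟧) :
    evalSeries (c + d) a = evalSeries c a + evalSeries d a := by
  ext n; simp [evalSeries, add_smul, Finset.sum_add_distrib]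

theorem evalSeries_one {a : A⟦X⟧} (ha : PowerSeries.constantCoeff a = 0) :
    evalSeries (1 : K⟦X⟧) a = 1 := by
  have := evalSeries_coe (1 : Polynomial K) ha
  simpa using this

theorem evalSeries_X {a : A⟦X⟧} (ha : PowerSeries.constantCoeff a = 0) :
    evalSeries (PowerSeries.X : K⟦X⟧) a = a := by
  have := evalSeries_coe (Polynomial.X : Polynomial K) ha
  simpa using this

theorem evalSeries_mul (c d : K⟦X⟧) {a : A⟦X⟧} (ha : PowerSeries.constantCoeff a = 0) :
    evalSeries (c * d) a = evalSeries c a * evalSeries d a := by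
  ext n
  rw [coeff_mul_congr (x' := Polynomial.aeval a (PowerSeries.trunc (n + 1) c))
      (y' := Polynomial.aeval a (PowerSeries.trunc (n + 1) d))
      (fun m hm => coeff_evalSeries_trunc c ha (by omega))
      (fun m hm => coeff_evalSeries_trunc d ha (by omega)), ← map_mul, ← evalSeries_coe _ ha]
  refine coeff_evalSeries_congr a fun k hk => ?_
  rw [Polynomial.coe_mul]
  exact PowerSeries.coeff_mul_eq_coeff_trunc_mul_trunc c d (by omega)

theorem evalSeries_pow (c : K⟦X⟧) {a : A⟦X⟧} (ha : PowerSeries.constantCoeff a = 0) (k : ℕ) :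
    evalSeries (c ^ k) a = evalSeries c a ^ k := by
  induction k with
  | zero => simpa using evalSeries_one ha
  | succ k ih => rw [pow_succ, pow_succ, evalSeries_mul _ _ ha, ih]

theorem constantCoeff_evalSeries (c : K⟦X⟧) (a : A⟦X⟧) :
    PowerSeries.constantCoeff (evalSeries c a) =
      PowerSeries.constantCoeff c • (1 : A) := by
  rw [← PowerSeries.coeff_zero_eq_constantCoeff_apply]
  simp [evalSeries]

theorem evalSeries_comp (c : K⟦X⟧) {d : K⟦X⟧} (hd : PowerSeries.constantCoeff d = 0) {a : A⟦X⟧}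
    (ha : PowerSeries.constantCoeff a = 0) :
    evalSeries c (evalSeries d a) = evalSeries (evalSeries c d) a := by
  ext n
  have h : ∀ m ∈ Finset.range (n + 1), PowerSeries.coeff m (evalSeries c d) =
      ∑ k ∈ Finset.range (n + 1), PowerSeries.coeff k c * PowerSeries.coeff m (d ^ k) := by
    intro m hm
    rw [coeff_evalSeries c hd (Finset.mem_range.1 hm)]
    simp
  rw [evalSeries, evalSeries.eq_def (evalSeries c d), PowerSeries.coeff_mk, PowerSeries.coeff_mk]
  rw [Finset.sum_congr (s₁ := Finset.range (n + 1))
    (f := fun m => PowerSeries.coeff m (evalSeries c d) • PowerSeries.coeff n (a ^ m)) rfl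
    fun m hm => by rw [h m hm, Finset.sum_smul], Finset.sum_comm]
  refine Finset.sum_congr rfl fun k _ => ?_
  rw [← evalSeries_pow _ ha, evalSeries.eq_def (d ^ k), PowerSeries.coeff_mk, Finset.smul_sum]
  simp only [mul_smul]

/-- An intertwiner of `a` and `b` intertwines their powers, hence any series in them. Every
conjugation of an exponential or a logarithm below is an instance. -/
theorem evalSeries_mul_eq_mul_evalSeries (c : K⟦X⟧) {a b y : A⟦X⟧}
    (ha : PowerSeries.constantCoeff a = 0) (hb : PowerSeries.constantCoeff b = 0)
    (h : a * y = y * b) : evalSeries c a * y = y * evalSeries c b := by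
  ext n
  rw [coeff_mul_congr (fun m (hm : m ≤ n) => coeff_evalSeries c ha (Nat.lt_succ_of_le hm))
    (fun m _ => rfl), coeff_mul_congr (x := y) (fun m _ => rfl)
    (fun m (hm : m ≤ n) => coeff_evalSeries c hb (Nat.lt_succ_of_le hm)),
    Finset.sum_mul, Finset.mul_sum]
  congr 1
  refine Finset.sum_congr rfl fun k _ => ?_
  have : SemiconjBy y b a := h.symm
  rw [smul_mul_assoc, mul_smul_comm, (this.pow_right k).eq]

theorem commute_evalSeries (c : K⟦X⟧) {a y : A⟦X⟧}
    (ha : PowerSeries.constantCoeff a = 0) (h : Commute y a) : Commute y (evalSeries c a) :=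
  (evalSeries_mul_eq_mul_evalSeries c ha ha h.eq.symm).symm

theorem map_evalSeries {A' : Type*} [Ring A'] [Algebra K A'] (φ : A →ₐ[K] A') (c : K⟦X⟧)
    (a : A⟦X⟧) : PowerSeries.map φ.toRingHom (evalSeries c a) =
      evalSeries c (PowerSeries.map φ.toRingHom a) := by
  ext n
  simp only [evalSeries, PowerSeries.coeff_map, PowerSeries.coeff_mk, map_sum, ← map_pow]
  refine Finset.sum_congr rfl fun k _ => ?_
  exact map_smul φ _ _

/-- For scalar series this gives access to the chain rule for `PowerSeries.subst`. -/
theorem evalSeries_eq_subst (c : K⟦X⟧) {d : K⟦X⟧} (hd : PowerSeries.constantCoeff d = 0) :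
    evalSeries c d = c.subst d := by
  ext n
  rw [PowerSeries.coeff_subst' (PowerSeries.HasSubst.of_constantCoeff_zero' hd), evalSeries,
    PowerSeries.coeff_mk]
  refine (finsum_eq_sum_of_support_subset _ fun k hk => ?_).symm
  by_contra hk'
  refine hk ?_
  beta_reduce
  rw [coeff_pow_eq_zero hd (by simpa using hk'), smul_zero]

variable [CharZero K]

/-- Taylor expansion of `f a * y` for an iterated commutator of length two. -/
theorem evalSeries_mul_of_commutator (c : K⟦X⟧) {a y z w : A⟦X⟧}
    (ha : PowerSeries.constantCoeff a = 0) (hy : a * y = y * a + z)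
    (hz : a * z = z * a + w) (hw : a * w = w * a) :
    evalSeries c a * y = y * evalSeries c a + z * evalSeries (PowerSeries.derivative K c) a +
      (2⁻¹ : K) • (w * evalSeries (PowerSeries.derivative K (PowerSeries.derivative K c)) a) := by
  have key : ∀ p : Polynomial K, Polynomial.aeval a p * y = y * Polynomial.aeval a p +
      z * Polynomial.aeval a (Polynomial.derivative p) +
      (2⁻¹ : K) •
        (w * Polynomial.aeval a (Polynomial.derivative (Polynomial.derivative p))) := by
    intro p
    have hz' : ∀ q : Polynomial K, Polynomial.aeval a q * z = z * Polynomial.aeval a q +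
        w * Polynomial.aeval a (Polynomial.derivative q) := by
      intro q
      induction q using Polynomial.induction_on' with
      | add p q hp hq => simp only [map_add, add_mul, mul_add, hp, hq]; abel
      | monomial n r =>
        induction n with
        | zero => simp [Algebra.commutes]
        | succ n ih =>
          rw [← Polynomial.monomial_mul_X, map_mul, Polynomial.aeval_X, mul_assoc, hz, mul_add,
            ← mul_assoc, ih, Polynomial.derivative_mul, Polynomial.derivative_X, map_add, map_mul,
            map_mul, Polynomial.aeval_X]
          have hw' : Polynomial.aeval a (Polynomial.monomial n r) * w =
              w * Polynomial.aeval a (Polynomial.monomial n r) := by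
            have : SemiconjBy w a a := hw.symm
            rw [Polynomial.aeval_monomial, mul_assoc, ← (this.pow_right n).eq, ← mul_assoc,
              Algebra.commutes, mul_assoc]
          rw [hw']
          simp only [map_one, mul_one]
          noncomm_ring
    induction p using Polynomial.induction_on' with
    | add p q hp hq => simp only [map_add, add_mul, mul_add, smul_add, hp, hq]; abel
    | monomial n r =>
      induction n with
      | zero => simp [Algebra.commutes]
      | succ n ih =>
        rw [← Polynomial.monomial_mul_X, map_mul, Polynomial.aeval_X, mul_assoc, hy, mul_add,
          ← mul_assoc, ih, hz' (Polynomial.monomial n r)]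
        simp only [Polynomial.derivative_mul, Polynomial.derivative_X, map_add, map_mul,
            Polynomial.aeval_X, mul_one, mul_add, add_mul, smul_add, smul_mul_assoc, ← mul_assoc]
        -- On the right `½ (pX)''` contributes `p'` as two separate halves, so the single `w p'` on
        -- the left is split to match.
        have h2 : ∀ u : A⟦X⟧, u = (2⁻¹ : K) • u + (2⁻¹ : K) • u := fun u => by
          rw [← add_smul]; norm_num
        conv_lhs =>
          rw [h2 (w * Polynomial.aeval a (Polynomial.derivative (Polynomial.monomial n r)))]
        abel
  ext n
  -- Each derivative lowers the truncation order by one, so the orders `n + 3`, `n + 2`, `n + 1`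
  -- make all three truncations derivatives of the same polynomial.
  have e1 := fun c : K⟦X⟧ => fun m (hm : m ≤ n) =>
    coeff_evalSeries_trunc c ha (N := n + 3) (show m < n + 3 by omega)
  have e2 := fun c : K⟦X⟧ => fun m (hm : m ≤ n) =>
    coeff_evalSeries_trunc c ha (N := n + 2) (show m < n + 2 by omega)
  have e3 := fun c : K⟦X⟧ => fun m (hm : m ≤ n) =>
    coeff_evalSeries_trunc c ha (N := n + 1) (show m < n + 1 by omega)
  rw [coeff_mul_congr (e1 c) (fun m _ => rfl), map_add, map_add, PowerSeries.coeff_smul,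
    coeff_mul_congr (x := y) (fun m _ => rfl) (e1 c),
    coeff_mul_congr (x := z) (fun m _ => rfl) (e2 _),
    coeff_mul_congr (x := w) (fun m _ => rfl) (e3 _), key, map_add, map_add,
    PowerSeries.coeff_smul, PowerSeries.trunc_derivative, PowerSeries.trunc_derivative,
    PowerSeries.trunc_derivative]

theorem constantCoeff_fexp (a : A⟦X⟧) : PowerSeries.constantCoeff (fexp K a) = 1 := by
  simp [fexp, constantCoeff_evalSeries]

theorem constantCoeff_flog (a : A⟦X⟧) : PowerSeries.constantCoeff (flog K a) = 0 := by
  simp [flog, constantCoeff_evalSeries]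

theorem fexp_zero : fexp K (0 : A⟦X⟧) = 1 := by
  ext n
  rw [fexp, coeff_evalSeries _ (by simp) (Nat.lt_succ_self n), Finset.sum_range_succ']
  simp

theorem flog_zero : flog K (0 : A⟦X⟧) = 0 := by
  ext n
  rw [flog, coeff_evalSeries _ (by simp) (Nat.lt_succ_self n), Finset.sum_range_succ']
  simp

theorem fexp_add {a b : A⟦X⟧} (ha : PowerSeries.constantCoeff a = 0)
    (hb : PowerSeries.constantCoeff b = 0) (h : Commute a b) :
    fexp K (a + b) = fexp K a * fexp K b := by
  ext n
  have hab : PowerSeries.constantCoeff (a + b) = 0 := by simp [ha, hb]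
  set f : ℕ → ℕ → A⟦X⟧ := fun i j =>
    (PowerSeries.coeff i (PowerSeries.exp K) • a ^ i) *
      (PowerSeries.coeff j (PowerSeries.exp K) • b ^ j) with hf
  have hpow : ∀ k, PowerSeries.coeff k (PowerSeries.exp K) • (a + b) ^ k =
      ∑ p ∈ Finset.HasAntidiagonal.antidiagonal k, f p.1 p.2 := by
    intro k
    rw [h.add_pow', Finset.smul_sum]
    refine Finset.sum_congr rfl fun p hp => ?_
    rw [Finset.HasAntidiagonal.mem_antidiagonal] at hp
    subst hp
    simp only [hf, smul_mul_smul_comm, PowerSeries.coeff_exp, ← Nat.cast_smul_eq_nsmul K,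
      smul_smul]
    congr 1
    rw [← map_natCast (algebraMap ℚ K), ← map_mul, ← map_mul]
    congr 1
    have := Nat.add_choose_mul_factorial_mul_factorial p.1 p.2
    rw [← Nat.choose_symm_add] at this
    rw [← this]
    push_cast
    have h1 : ((p.1.factorial : ℕ) : ℚ) ≠ 0 := by exact_mod_cast p.1.factorial_ne_zero
    have h2 : ((p.2.factorial : ℕ) : ℚ) ≠ 0 := by exact_mod_cast p.2.factorial_ne_zero
    have h3 : (((p.1 + p.2).choose p.1 : ℕ) : ℚ) ≠ 0 := by
      exact_mod_cast (Nat.choose_pos (Nat.le_add_right _ _)).ne'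
    field_simp
  -- Both `a` and `b` are divisible by the central `X`, so `a ^ i * b ^ j` is divisible by `X ^ (i +
  -- j)`.
  have hvan : ∀ i j, n < i + j → PowerSeries.coeff n (f i j) = 0 := by
    intro i j hij
    simp only [hf, smul_mul_smul_comm, PowerSeries.coeff_smul]
    obtain ⟨u, rfl⟩ := PowerSeries.X_dvd_iff.2 ha
    obtain ⟨v, rfl⟩ := PowerSeries.X_dvd_iff.2 hb
    rw [((PowerSeries.commute_X u).symm).mul_pow, ((PowerSeries.commute_X v).symm).mul_pow,
      mul_assoc, ← mul_assoc (u ^ i), (PowerSeries.commute_X_pow (u ^ i) j).eq, mul_assoc,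
      ← mul_assoc, ← pow_add, PowerSeries.coeff_X_pow_mul', if_neg (by omega), smul_zero]
  rw [fexp, fexp, fexp, coeff_evalSeries _ hab (Nat.lt_succ_self n),
    coeff_mul_congr
      (fun m (hm : m ≤ n) => coeff_evalSeries (PowerSeries.exp K) ha (Nat.lt_succ_of_le hm))
      (fun m (hm : m ≤ n) => coeff_evalSeries (PowerSeries.exp K) hb (Nat.lt_succ_of_le hm)),
    Finset.sum_mul_sum, map_sum, map_sum]
  simp only [hpow, map_sum]
  rw [← Finset.sum_product', Finset.sum_sigma']
  -- The antidiagonals fill the triangle `i + j ≤ n` of the square; outside it the terms vanish by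
  -- `hvan`.
  refine Finset.sum_bij_ne_zero (fun q _ _ => (q.2.1, q.2.2)) ?_ ?_ ?_ ?_
  · rintro ⟨k, p⟩ hq _
    simp only [Finset.mem_sigma, Finset.mem_range, Finset.HasAntidiagonal.mem_antidiagonal] at hq
    simp only [Finset.mem_product, Finset.mem_range]
    omega
  · rintro ⟨k, p⟩ hq _ ⟨k', p'⟩ hq' _ e
    simp only [Finset.mem_sigma, Finset.mem_range, Finset.HasAntidiagonal.mem_antidiagonal]
      at hq hq'
    obtain ⟨-, rfl⟩ := hq
    obtain ⟨-, rfl⟩ := hq'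
    have : p = p' := by simpa using e
    subst this; rfl
  · rintro ⟨i, j⟩ hq hne
    refine ⟨⟨i + j, (i, j)⟩, ?_, hne, rfl⟩
    simp only [Finset.mem_sigma, Finset.mem_range, Finset.HasAntidiagonal.mem_antidiagonal,
      and_true]
    by_contra hlt
    exact hne (hvan i j (by omega))
  · intros; rfl

theorem fexp_mul_fexp_neg {a : A⟦X⟧} (ha : PowerSeries.constantCoeff a = 0) :
    fexp K a * fexp K (-a) = 1 := by
  rw [← fexp_add ha (by simp [ha]) ((Commute.refl a).neg_right), add_neg_cancel, fexp_zero]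

theorem isUnit_fexp {a : A⟦X⟧} (ha : PowerSeries.constantCoeff a = 0) : IsUnit (fexp K a) := by
  refine ⟨⟨fexp K a, fexp K (-a), fexp_mul_fexp_neg ha, ?_⟩, rfl⟩
  simpa using fexp_mul_fexp_neg (K := K) (a := -a) (by simp [ha])

theorem fexp_mul_eq_mul_fexp {a b y : A⟦X⟧} (ha : PowerSeries.constantCoeff a = 0)
    (hb : PowerSeries.constantCoeff b = 0) (h : a * y = y * b) :
    fexp K a * y = y * fexp K b :=
  evalSeries_mul_eq_mul_evalSeries _ ha hb h

variable (K) in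
theorem deriv_log_mul_one_add_X :
    PowerSeries.derivative K (PowerSeries.log K) * (1 + PowerSeries.X) = 1 := by
  rw [PowerSeries.deriv_log]
  ext n
  rw [mul_add, mul_one, map_add]
  cases n with
  | zero => simp
  | succ n => simp [PowerSeries.coeff_succ_mul_X, PowerSeries.coeff_one, pow_succ]

variable (K) in
-- Both sides vanish at `0` and have derivative `1`: substituting `exp - 1` into `log' * (1 + X) =
-- 1` gives exactly the chain-rule expression.
theorem log_comp_exp_sub_one :
    evalSeries (PowerSeries.log K) (PowerSeries.exp K - 1) = PowerSeries.X := by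
  have hs := PowerSeries.HasSubst.exp_sub_one (A := K)
  rw [evalSeries_eq_subst _ (by simp)]
  refine PowerSeries.derivative.ext ?_ ?_
  · rw [PowerSeries.derivative_subst hs, PowerSeries.derivative_X, map_sub,
      PowerSeries.derivative_exp, PowerSeries.derivative_one, sub_zero]
    have := congrArg (PowerSeries.subst (PowerSeries.exp K - 1)) (deriv_log_mul_one_add_X K)
    rw [PowerSeries.subst_mul hs, PowerSeries.subst_add hs, PowerSeries.subst_X hs,
      ← PowerSeries.coe_substAlgHom hs, map_one, add_sub_cancel] at this
    rwa [PowerSeries.coe_substAlgHom hs] at this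
  · rw [← evalSeries_eq_subst _ (by simp), constantCoeff_evalSeries]
    simp

variable (K) in
-- With `f = exp ∘ log` and `m = log'`, one has `f' = f m` and `m' = -m²`. So `f m` has zero
-- derivative and equals `1`, while `m` is inverse to `1 + X`.
theorem exp_comp_log :
    evalSeries (PowerSeries.exp K) (PowerSeries.log K) = 1 + PowerSeries.X := by
  have hs := PowerSeries.HasSubst.log (A := K)
  set f := evalSeries (PowerSeries.exp K) (PowerSeries.log K) with hf
  set m := PowerSeries.derivative K (PowerSeries.log K) with hm
  have hm1 : m * (1 + PowerSeries.X) = 1 := deriv_log_mul_one_add_X K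
  have hm' : PowerSeries.derivative K m = - m ^ 2 := by
    have := congrArg (PowerSeries.derivative K) hm1
    rw [Derivation.leibniz, map_add, PowerSeries.derivative_one, PowerSeries.derivative_X, zero_add,
      smul_eq_mul, smul_eq_mul, mul_one] at this
    linear_combination m * this - PowerSeries.derivative K m * hm1
  have hf' : PowerSeries.derivative K f = f * m := by
    rw [hf, evalSeries_eq_subst _ (by simp), PowerSeries.derivative_subst hs,
      PowerSeries.derivative_exp]
  have h1 : f * m = 1 := by
    refine PowerSeries.derivative.ext ?_ ?_
    · rw [Derivation.leibniz, hf', hm', PowerSeries.derivative_one, smul_eq_mul, smul_eq_mul]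
      ring
    · have : PowerSeries.constantCoeff m = 1 := by
        have := congrArg PowerSeries.constantCoeff hm1
        simpa using this
      simp [hf, constantCoeff_evalSeries, this]
  linear_combination (1 + PowerSeries.X) * h1 - f * hm1

theorem fexp_flog {a : A⟦X⟧} (ha : PowerSeries.constantCoeff a = 0) :
    fexp K (flog K a) = 1 + a := by
  rw [fexp, flog, evalSeries_comp _ (by simp) ha, exp_comp_log, evalSeries_add, evalSeries_one ha,
    evalSeries_X ha]

theorem flog_fexp_sub_one {a : A⟦X⟧} (ha : PowerSeries.constantCoeff a = 0) :
    flog K (fexp K a - 1) = a := by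
  have : fexp K a - 1 = evalSeries (PowerSeries.exp K - 1) a := by
    rw [sub_eq_iff_eq_add]
    conv_rhs => rw [← evalSeries_one (K := K) ha]
    rw [← evalSeries_add, sub_add_cancel, fexp]
  rw [this, flog, evalSeries_comp _ (by simp) ha, log_comp_exp_sub_one, evalSeries_X ha]

/-- The hypothesis `hc` is `1 + c = (1 + a)(1 + b)`, in the form in which conjugation by a Jordanian
factor produces it. -/
theorem flog_eq_add {a b c : A⟦X⟧} (ha : PowerSeries.constantCoeff a = 0)
    (hb : PowerSeries.constantCoeff b = 0) (h : Commute a b) (hc : c = a * (1 + b) + b) :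
    flog K c = flog K a + flog K b := by
  have h' : Commute (flog K a) (flog K b) :=
    commute_evalSeries _ hb (commute_evalSeries _ ha h.symm).symm
  rw [← flog_fexp_sub_one (K := K) (a := flog K a + flog K b) (by simp [constantCoeff_flog]),
    fexp_add (constantCoeff_flog _) (constantCoeff_flog _) h', fexp_flog ha, fexp_flog hb, hc]
  congr 1
  noncomm_ring

/-- The adjoint series `e^a y e^{-a}` stops after the second commutator. -/
theorem fexp_mul_of_commutator {a y z w : A⟦X⟧}
    (ha : PowerSeries.constantCoeff a = 0) (hy : a * y = y * a + z)
    (hz : a * z = z * a + w) (hw : a * w = w * a) :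
    fexp K a * y = (y + z + (2⁻¹ : K) • w) * fexp K a := by
  rw [fexp, evalSeries_mul_of_commutator _ ha hy hz hw, PowerSeries.derivative_exp,
    PowerSeries.derivative_exp, add_mul, add_mul, smul_mul_assoc]

end Series

/-! ### Coefficientwise extension of algebra homomorphisms to power series. -/

section MapAlg

variable {K : Type*} [Field K]
variable {A B C : Type*} [Ring A] [Algebra K A] [Ring B] [Algebra K B] [Ring C]
  [Algebra K C]

/-- The ring homomorphism of power series induced by an algebra homomorphism. -/
def mapAlg (φ : A →ₐ[K] B) : A⟦X⟧ →+* B⟦X⟧ := PowerSeries.map φ.toRingHom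

theorem coeff_mapAlg (φ : A →ₐ[K] B) (n : ℕ) (a : A⟦X⟧) :
    PowerSeries.coeff n (mapAlg φ a) = φ (PowerSeries.coeff n a) := by
  simp [mapAlg]

theorem mapAlg_comp (ψ : B →ₐ[K] C) (φ : A →ₐ[K] B) (a : A⟦X⟧) :
    mapAlg ψ (mapAlg φ a) = mapAlg (ψ.comp φ) a := by
  ext n; simp [coeff_mapAlg]

theorem mapAlg_smul (φ : A →ₐ[K] B) (r : K) (a : A⟦X⟧) : mapAlg φ (r • a) = r • mapAlg φ a := by
  ext n; simp [coeff_mapAlg]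

theorem constantCoeff_mapAlg (φ : A →ₐ[K] B) (a : A⟦X⟧) :
    PowerSeries.constantCoeff (mapAlg φ a) = φ (PowerSeries.constantCoeff a) := by
  rw [← PowerSeries.coeff_zero_eq_constantCoeff_apply, coeff_mapAlg,
    PowerSeries.coeff_zero_eq_constantCoeff_apply]

theorem constantCoeff_mapAlg_eq_zero (φ : A →ₐ[K] B) {a : A⟦X⟧}
    (ha : PowerSeries.constantCoeff a = 0) : PowerSeries.constantCoeff (mapAlg φ a) = 0 := by
  rw [constantCoeff_mapAlg, ha, map_zero]

theorem commute_mapAlg {φ : A →ₐ[K] C} {ψ : B →ₐ[K] C}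
    (h : ∀ a b, Commute (φ a) (ψ b)) (a : A⟦X⟧) (b : B⟦X⟧) :
    Commute (mapAlg φ a) (mapAlg ψ b) := by
  change _ = _
  ext n
  rw [PowerSeries.coeff_mul, PowerSeries.coeff_mul, ← Finset.Nat.sum_antidiagonal_swap]
  refine Finset.sum_congr rfl fun p _ => ?_
  simp only [coeff_mapAlg, Prod.fst_swap, Prod.snd_swap]
  exact (h _ _).eq

variable [CharZero K]

theorem mapAlg_fexp (φ : A →ₐ[K] B) (a : A⟦X⟧) :
    mapAlg φ (fexp K a) = fexp K (mapAlg φ a) := map_evalSeries φ _ a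

theorem mapAlg_flog (φ : A →ₐ[K] B) (a : A⟦X⟧) :
    mapAlg φ (flog K a) = flog K (mapAlg φ a) := map_evalSeries φ _ a

end MapAlg

/-! ### Tensor legs: embeddings, coproducts and counits on them. -/

section Legs

variable (K : Type*) [Field K] (L : Type*) [LieRing L] [LieAlgebra K L]

/-- The embedding `u ↦ u ⊗ 1`. -/
def inclLeft : U K L →ₐ[K] U K L ⊗[K] U K L := Algebra.TensorProduct.includeLeft

/-- The embedding `u ↦ 1 ⊗ u`. -/
def inclRight : U K L →ₐ[K] U K L ⊗[K] U K L := Algebra.TensorProduct.includeRight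

/-- The embedding `t ↦ t ⊗ 1` of the tensor square into the tensor cube. -/
def incl12 : U K L ⊗[K] U K L →ₐ[K] (U K L ⊗[K] U K L) ⊗[K] U K L :=
  Algebra.TensorProduct.includeLeft

/-- The embedding `t ↦ 1 ⊗ t` of the tensor square into the tensor cube. -/
def incl23 : U K L ⊗[K] U K L →ₐ[K] (U K L ⊗[K] U K L) ⊗[K] U K L :=
  (Algebra.TensorProduct.assoc K K K (U K L) (U K L) (U K L)).symm.toAlgHom.comp
    (Algebra.TensorProduct.includeRight :
      U K L ⊗[K] U K L →ₐ[K] U K L ⊗[K] (U K L ⊗[K] U K L))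

/-- The homomorphism `Δ ⊗ id`. -/
def comulTensorId : U K L ⊗[K] U K L →ₐ[K] (U K L ⊗[K] U K L) ⊗[K] U K L :=
  Algebra.TensorProduct.map (comul K L) (AlgHom.id K (U K L))

/-- The homomorphism `id ⊗ Δ`. -/
def idTensorComul : U K L ⊗[K] U K L →ₐ[K] (U K L ⊗[K] U K L) ⊗[K] U K L :=
  (Algebra.TensorProduct.assoc K K K (U K L) (U K L) (U K L)).symm.toAlgHom.comp
    (Algebra.TensorProduct.map (AlgHom.id K (U K L)) (comul K L))

/-- The homomorphism `ε ⊗ id`. -/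
def counitTensorId : U K L ⊗[K] U K L →ₐ[K] U K L :=
  (Algebra.TensorProduct.lid K (U K L)).toAlgHom.comp
    (Algebra.TensorProduct.map (counit K L) (AlgHom.id K (U K L)))

/-- The homomorphism `id ⊗ ε`. -/
def idTensorCounit : U K L ⊗[K] U K L →ₐ[K] U K L :=
  (Algebra.TensorProduct.rid K K (U K L)).toAlgHom.comp
    (Algebra.TensorProduct.map (AlgHom.id K (U K L)) (counit K L))

/-- This and the next identities bring every term of the cocycle equation to a normal form in the
three legs. -/
theorem comulTensorId_comp_inclLeft :
    (comulTensorId K L).comp (inclLeft K L) = (incl12 K L).comp (comul K L) := by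
  apply AlgHom.ext; intro u
  simp [comulTensorId, inclLeft, incl12]

theorem comulTensorId_comp_inclRight :
    (comulTensorId K L).comp (inclRight K L) = (incl23 K L).comp (inclRight K L) := by
  apply AlgHom.ext; intro u
  simp [comulTensorId, inclRight, incl23, Algebra.TensorProduct.one_def]

theorem idTensorComul_comp_inclLeft :
    (idTensorComul K L).comp (inclLeft K L) = (incl12 K L).comp (inclLeft K L) := by
  apply AlgHom.ext; intro u
  simp [idTensorComul, inclLeft, incl12, Algebra.TensorProduct.one_def]

theorem idTensorComul_comp_inclRight :
    (idTensorComul K L).comp (inclRight K L) = (incl23 K L).comp (comul K L) := by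
  apply AlgHom.ext; intro u
  simp [idTensorComul, inclRight, incl23]

theorem incl23_comp_inclLeft :
    (incl23 K L).comp (inclLeft K L) = (incl12 K L).comp (inclRight K L) := by
  apply AlgHom.ext; intro u
  simp [inclLeft, incl12, incl23, inclRight]

theorem counitTensorId_comp_inclLeft :
    (counitTensorId K L).comp (inclLeft K L) = (Algebra.ofId K (U K L)).comp (counit K L) := by
  apply AlgHom.ext; intro u
  simp [counitTensorId, inclLeft, Algebra.ofId_apply, Algebra.algebraMap_eq_smul_one]

theorem idTensorCounit_comp_inclRight :
    (idTensorCounit K L).comp (inclRight K L) = (Algebra.ofId K (U K L)).comp (counit K L) := by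
  apply AlgHom.ext; intro u
  simp [idTensorCounit, inclRight, Algebra.ofId_apply, Algebra.algebraMap_eq_smul_one]

theorem commute_inclLeft_inclRight (a b : U K L) :
    Commute (inclLeft K L a) (inclRight K L b) := by
  simp [inclLeft, inclRight, Commute, SemiconjBy]

theorem commute_incl12_incl23 (t : U K L ⊗[K] U K L) (b : U K L) :
    Commute (incl12 K L t) ((incl23 K L).comp (inclRight K L) b) := by
  -- Through `comulTensorId` the element becomes the pure tensor `(1 ⊗ 1) ⊗ b`, with no associator
  -- left.
  rw [← comulTensorId_comp_inclRight]
  simp [comulTensorId, inclRight, incl12, Commute, SemiconjBy]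

theorem commute_incl23_incl12 (t : U K L ⊗[K] U K L) (b : U K L) :
    Commute (incl23 K L t) ((incl12 K L).comp (inclLeft K L) b) := by
  have h : (incl12 K L).comp (inclLeft K L) b =
      (Algebra.TensorProduct.assoc K K K (U K L) (U K L) (U K L)).symm (b ⊗ₜ 1) := by
    simp [incl12, inclLeft, Algebra.TensorProduct.one_def]
  have h' : incl23 K L t =
      (Algebra.TensorProduct.assoc K K K (U K L) (U K L) (U K L)).symm (1 ⊗ₜ t) := rfl
  rw [h, h', Commute, SemiconjBy, ← map_mul, ← map_mul]
  simp

end Legs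

/-! ### The exponential identities behind the two kinds of twist. -/

section ExponentialIdentities

variable {K : Type*} [Field K] [CharZero K]
variable {R : Type*} [Ring R] [Algebra K R]

theorem constantCoeff_mul_right_eq_zero (a : R⟦X⟧) {b : R⟦X⟧}
    (hb : PowerSeries.constantCoeff b = 0) : PowerSeries.constantCoeff (a * b) = 0 := by
  rw [map_mul, hb, mul_zero]

/-- Conjugation of an eigenvector of `ad t` by `exp (t s)`. -/
theorem fexp_mul_eigenvector {t s y : R⟦X⟧} (r : K) (hs : PowerSeries.constantCoeff s = 0)
    (hts : Commute t s) (hys : Commute y s) (h : t * y - y * t = r • y) :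
    fexp K (t * s) * y = y * fexp K (r • s) * fexp K (t * s) := by
  have hs' : PowerSeries.constantCoeff (r • s) = 0 := by simp [hs]
  have hc : Commute (r • s) (t * s) :=
    ((hts.symm.mul_right (Commute.refl s))).smul_left r
  rw [mul_assoc, ← fexp_add hs' (constantCoeff_mul_right_eq_zero _ hs) hc]
  refine fexp_mul_eq_mul_fexp (constantCoeff_mul_right_eq_zero _ hs)
    (by simp [hs, map_mul]) ?_
  rw [mul_assoc, ← hys.eq, ← mul_assoc, sub_eq_iff_eq_add.1 h, mul_add, add_mul, smul_mul_assoc,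
    mul_smul_comm, mul_assoc]

theorem fexp_mul_commute {a y : R⟦X⟧} (ha : PowerSeries.constantCoeff a = 0) (h : Commute a y) :
    fexp K a * y = y * fexp K a :=
  fexp_mul_eq_mul_fexp ha ha h.eq

/-- Subscripts are tensor legs, and `q` plays the coproduct of `s` in legs 2 and 3. Moving `exp (t₂
s₃)` past `exp (t₁ q)` turns `q` into `s₂ + s₃`; both sides become `exp (t₁ s₂) exp (t₁ s₃) exp (t₂
s₃)`. -/
theorem fexp_jordanian_cocycle {t₁ t₂ s₂ s₃ q : R⟦X⟧} (hs₂ : PowerSeries.constantCoeff s₂ = 0)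
    (hs₃ : PowerSeries.constantCoeff s₃ = 0) (hq : PowerSeries.constantCoeff q = 0)
    (h₁₂ : Commute t₁ t₂) (h₁₂' : Commute t₁ s₂) (h₁₃ : Commute t₁ s₃) (h₂₃ : Commute t₂ s₃)
    (h₂₃' : Commute s₂ s₃) (h : fexp K (t₂ * s₃) * q = (s₂ + s₃) * fexp K (t₂ * s₃)) :
    fexp K (t₁ * s₂) * fexp K ((t₁ + t₂) * s₃) = fexp K (t₂ * s₃) * fexp K (t₁ * q) := by
  have z₃ := constantCoeff_mul_right_eq_zero t₂ hs₃
  have z₂ := constantCoeff_mul_right_eq_zero t₁ hs₂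
  have z₁ := constantCoeff_mul_right_eq_zero t₁ hs₃
  have c₁ : Commute t₁ (t₂ * s₃) := h₁₂.mul_right h₁₃
  have e : fexp K (t₁ * (s₂ + s₃)) * fexp K (t₂ * s₃) = fexp K (t₂ * s₃) * fexp K (t₁ * q) := by
    refine fexp_mul_eq_mul_fexp (by simp [hs₂, hs₃]) (by simp [hq]) ?_
    rw [mul_assoc, ← h, ← mul_assoc, ← mul_assoc, fexp_mul_commute z₃ c₁.symm]
  rw [← e, add_mul, fexp_add z₁ z₃, mul_add, fexp_add z₂ z₁, mul_assoc]
  · exact ((Commute.refl t₁).mul_right h₁₃).mul_left (h₁₂'.symm.mul_right h₂₃')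
  · exact c₁.mul_left (h₂₃.symm.mul_right (Commute.refl s₃))

/-- The commutator of `a₂ b₃` with `a₁ (b₂ + v₂ b₃)` is `a₁ (u₂ - v₂) b₃`, which commutes with `a₂
b₃`. So conjugation by `exp (a₂ b₃)` just replaces `v₂` by `u₂`, after which the summands in the
exponents commute and split. -/
theorem fexp_extension_cocycle {a₁ a₂ b₂ u₂ v₂ b₃ : R⟦X⟧}
    (hb₂ : PowerSeries.constantCoeff b₂ = 0) (hb₃ : PowerSeries.constantCoeff b₃ = 0)
    (haa : Commute a₁ a₂) (hab : Commute a₁ b₂) (hau : Commute a₁ u₂)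
    (hab₃ : Commute a₁ b₃) (ha₂b₃ : Commute a₂ b₃) (hbb : Commute b₂ b₃) (hub : Commute u₂ b₃)
    (hvb : Commute v₂ b₃) (hua₂ : Commute u₂ a₂) (hub₂ : Commute u₂ b₂) (hva₂ : Commute v₂ a₂)
    (h : a₂ * b₂ - b₂ * a₂ = u₂ - v₂) :
    fexp K (a₁ * b₂) * fexp K ((a₁ * u₂ + a₂) * b₃) =
      fexp K (a₂ * b₃) * fexp K (a₁ * (b₂ + v₂ * b₃)) := by
  have z₂ := constantCoeff_mul_right_eq_zero a₁ hb₂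
  have z₃ := constantCoeff_mul_right_eq_zero a₂ hb₃
  have zu := constantCoeff_mul_right_eq_zero (a₁ * u₂) hb₃
  have cz : Commute (a₂ * b₃) (a₁ * (u₂ - v₂) * b₃) :=
    ((haa.symm.mul_right (hua₂.symm.sub_right hva₂.symm)).mul_right ha₂b₃).mul_left
      ((hab₃.symm.mul_right (hub.symm.sub_right hvb.symm)).mul_right (Commute.refl b₃))
  have hb : Commute (a₂ * b₃) (a₁ * v₂ * b₃) :=
    ((haa.symm.mul_right hva₂.symm).mul_right ha₂b₃).mul_left
      ((hab₃.symm.mul_right hvb.symm).mul_right (Commute.refl b₃))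
  have hcomm : a₂ * b₃ * (a₁ * (b₂ + v₂ * b₃)) =
      a₁ * (b₂ + v₂ * b₃) * (a₂ * b₃) + a₁ * (u₂ - v₂) * b₃ := by
    have h1 : a₂ * b₃ * (a₁ * b₂) = a₁ * (a₂ * b₂) * b₃ := by
      rw [mul_assoc, ← mul_assoc b₃, ← hab₃.eq, mul_assoc, ← hbb.eq, ← mul_assoc, ← haa.eq]
      simp only [mul_assoc]
    have h2 : a₁ * b₂ * (a₂ * b₃) = a₁ * (b₂ * a₂) * b₃ := by simp only [mul_assoc]
    rw [mul_add, mul_add, add_mul, ← mul_assoc a₁ v₂, hb.eq, h1, h2, ← h]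
    noncomm_ring
  have key := fexp_mul_of_commutator (K := K) z₃ hcomm (w := 0) (by rw [cz.eq, add_zero]) (by simp)
  rw [smul_zero, add_zero] at key
  have e : a₁ * (b₂ + v₂ * b₃) + a₁ * (u₂ - v₂) * b₃ = a₁ * b₂ + a₁ * u₂ * b₃ := by noncomm_ring
  rw [e] at key
  -- The conjugation `key` is itself an intertwining relation, so it passes to the exponentials of
  -- the conjugated elements.
  have := fexp_mul_eq_mul_fexp (K := K) (by simp [hb₂, hb₃]) (by simp [hb₂, hb₃]) key.symm
  rw [← this, fexp_add z₂ zu, add_mul, fexp_add zu z₃, ← mul_assoc]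
  · exact (haa.mul_left hua₂).mul_left ha₂b₃.symm |>.mul_right
      ((hab₃.mul_left hub).mul_left (Commute.refl b₃))
  · exact (((Commute.refl a₁).mul_right hau).mul_right hab₃).mul_left
      ((hab.symm.mul_right hub₂.symm).mul_right hbb)

end ExponentialIdentities

/-! ### Extending a twist by one more exponential factor. -/

section Twist

variable {K : Type*} [Field K] {L : Type*} [LieRing L] [LieAlgebra K L]

local notation "ι₁" => mapAlg (inclLeft _ _)
local notation "ι₂" => mapAlg (inclRight _ _)
local notation "δ" => mapAlg (comul _ _)
local notation "κ₁" => mapAlg (AlgHom.comp (incl12 _ _) (inclLeft _ _))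
local notation "κ₂" => mapAlg (AlgHom.comp (incl12 _ _) (inclRight _ _))
local notation "κ₃" => mapAlg (AlgHom.comp (incl23 _ _) (inclRight _ _))

theorem tens_eq (a b : Uh K L) : tens K (U K L) a b = ι₁ a * ι₂ b := rfl

theorem commute_left_right (a b : Uh K L) : Commute (ι₁ a : Uh2 K L) (ι₂ b) :=
  commute_mapAlg (commute_inclLeft_inclRight K L) a b

theorem isPrimitiveFor_iff {F : Uh2 K L} (hF : IsUnit F) {x : Uh K L} :
    IsPrimitiveFor F x ↔ F * δ x = (ι₁ x + ι₂ x) * F := by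
  have h : IsPrimitiveFor F x ↔ F * δ x * Ring.inverse F = ι₁ x + ι₂ x := by
    simp only [IsPrimitiveFor, twistedComul, tens_eq, map_one, mul_one, one_mul]
    rfl
  rw [h]
  constructor
  · intro e
    rw [← e, mul_assoc, Ring.inverse_mul_cancel _ hF, mul_one]
  · intro e
    rw [e, mul_assoc, Ring.mul_inverse_cancel _ hF, mul_one]

/-- Starting point: `IsTwist.jordanian_mul` applied to it gives the plain Jordanian twist. -/
theorem isTwist_one : IsTwist (1 : Uh2 K L) where
  isUnit := isUnit_one
  constantCoeff := map_one _
  cocycle := by simp [leg12, leg23, comulLeft, comulRight]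
  counit_left := by simp [counitLeft]
  counit_right := by simp [counitRight]

variable [CharZero K]

/-- A sufficient condition for `exp (a ⊗ b) F` to be a twist, in terms of the coproduct twisted
by `F`. -/
theorem IsTwist.fexp_mul {F : Uh2 K L} (hF : IsTwist F) {a b : Uh K L} {a' b' : Uh2 K L}
    (hb₀ : PowerSeries.constantCoeff b = 0) (hb'₀ : PowerSeries.constantCoeff b' = 0)
    (ha : F * δ a = a' * F) (hb : F * δ b = b' * F)
    (hc : fexp K (κ₁ a * κ₂ b : Uh3 K L) * fexp K (mapAlg (incl12 K L) a' * κ₃ b) =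
      fexp K (κ₂ a * κ₃ b) * fexp K (κ₁ a * mapAlg (incl23 K L) b'))
    (hεa : mapAlg (counit K L) a = 0) (hεb : mapAlg (counit K L) b = 0) :
    IsTwist (fexp K (tens K (U K L) a b) * F) := by
  have hz₂ : PowerSeries.constantCoeff (ι₂ b : Uh2 K L) = 0 := constantCoeff_mapAlg_eq_zero _ hb₀
  have hz : PowerSeries.constantCoeff (tens K (U K L) a b) = 0 :=
    constantCoeff_mul_right_eq_zero _ hz₂
  have hz₃ : PowerSeries.constantCoeff (κ₃ b : Uh3 K L) = 0 := constantCoeff_mapAlg_eq_zero _ hb₀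
  refine ⟨(isUnit_fexp hz).mul hF.isUnit, ?_, ?_, ?_, ?_⟩
  · rw [map_mul, constantCoeff_fexp, hF.constantCoeff, mul_one]
  · have hFc : mapAlg (incl12 K L) F * mapAlg (comulTensorId K L) F =
      mapAlg (incl23 K L) F * mapAlg (idTensorComul K L) F := hF.cocycle
    change mapAlg (incl12 K L) _ * mapAlg (comulTensorId K L) _ =
      mapAlg (incl23 K L) _ * mapAlg (idTensorComul K L) _
    simp only [map_mul, mapAlg_fexp, tens_eq, mapAlg_comp, comulTensorId_comp_inclLeft,
      comulTensorId_comp_inclRight, idTensorComul_comp_inclLeft, idTensorComul_comp_inclRight,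
      incl23_comp_inclLeft]
    -- `F₁₂` commutes with the third leg, so moving it to the right only replaces `Δ a` by `a'`;
    -- `hr` does the same for `F₂₃` and the first leg.
    have hl : mapAlg (incl12 K L) F *
        fexp K (mapAlg ((incl12 K L).comp (comul K L)) a * κ₃ b) =
        fexp K (mapAlg (incl12 K L) a' * κ₃ b) * mapAlg (incl12 K L) F := by
      refine (fexp_mul_eq_mul_fexp (constantCoeff_mul_right_eq_zero _ hz₃)
        (constantCoeff_mul_right_eq_zero _ hz₃) ?_).symm
      rw [← mapAlg_comp (incl12 K L) (comul K L), ← mul_assoc, ← map_mul, ha, map_mul, mul_assoc,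
        mul_assoc, (commute_mapAlg (commute_incl12_incl23 K L) F b).eq]
    have hr : mapAlg (incl23 K L) F *
        fexp K (κ₁ a * mapAlg ((incl23 K L).comp (comul K L)) b) =
        fexp K (κ₁ a * mapAlg (incl23 K L) b') * mapAlg (incl23 K L) F := by
      refine (fexp_mul_eq_mul_fexp
        (constantCoeff_mul_right_eq_zero _ (constantCoeff_mapAlg_eq_zero _ hb'₀))
        (constantCoeff_mul_right_eq_zero _ (constantCoeff_mapAlg_eq_zero _ hb₀)) ?_).symm
      rw [← mapAlg_comp (incl23 K L) (comul K L), mul_assoc, ← map_mul, ← hb, map_mul, ← mul_assoc,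
        ← mul_assoc, (commute_mapAlg (commute_incl23_incl12 K L) F a).eq]
    -- Once `F₁₂` and `F₂₃` stand next to the coproducts of `F`, the cocycle equation of `F` matches
    -- them, and `hc` is what remains.
    rw [mul_assoc, ← mul_assoc (mapAlg (incl12 K L) F), hl, mul_assoc (fexp K _), hFc,
      mul_assoc (fexp K (κ₂ a * κ₃ b)), ← mul_assoc (mapAlg (incl23 K L) F), hr, ← mul_assoc, hc]
    simp only [mul_assoc]
  · have h1 : mapAlg (counitTensorId K L) F = 1 := hF.counit_left
    change mapAlg (counitTensorId K L) _ = 1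
    rw [map_mul, h1, mul_one, mapAlg_fexp, tens_eq, map_mul, mapAlg_comp,
      counitTensorId_comp_inclLeft, ← mapAlg_comp, hεa, map_zero, zero_mul, fexp_zero]
  · have h1 : mapAlg (idTensorCounit K L) F = 1 := hF.counit_right
    change mapAlg (idTensorCounit K L) _ = 1
    rw [map_mul, h1, mul_one, mapAlg_fexp, tens_eq, map_mul, mapAlg_comp _ (inclRight K L),
      idTensorCounit_comp_inclRight, ← mapAlg_comp _ (counit K L), hεb, map_zero, mul_zero,
      fexp_zero]

theorem constantCoeff_tens_flog (T P : Uh K L) :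
    PowerSeries.constantCoeff (tens K (U K L) T (flog K P)) = 0 :=
  constantCoeff_mul_right_eq_zero _ (constantCoeff_mapAlg_eq_zero _ (constantCoeff_flog P))

theorem jordanian_mul_left {T P y : Uh K L} (r : K) (h : T * y - y * T = r • y) :
    jordanian T P * ι₁ y = ι₁ y * ι₂ (fexp K (r • flog K P)) * jordanian T P := by
  rw [mapAlg_fexp, mapAlg_smul]
  refine fexp_mul_eigenvector r (constantCoeff_mapAlg_eq_zero _ (constantCoeff_flog P))
    (commute_left_right _ _) (commute_left_right _ _) ?_
  rw [← mapAlg_smul, ← h, map_sub, map_mul, map_mul]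
  rfl

theorem jordanian_mul_right {T P y : Uh K L} (hP : PowerSeries.constantCoeff P = 0)
    (h : Commute P y) : jordanian T P * ι₂ y = ι₂ y * jordanian T P := by
  refine fexp_mul_commute (constantCoeff_tens_flog T P) ?_
  exact (commute_left_right T y).mul_left ((commute_evalSeries _ hP h.symm).symm.map _)

/-- Conjugation sends `P ⊗ 1 + 1 ⊗ P` to `P ⊗ (1 + P) + 1 ⊗ P`, which is `(1 + P) ⊗ (1 + P) - 1`.
Taking logarithms makes `σ` primitive. -/
theorem jordanian_mul_flog {T P : Uh K L} (hP : PowerSeries.constantCoeff P = 0)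
    (h : T * P - P * T = P) :
    jordanian T P * flog K (ι₁ P + ι₂ P) = (ι₁ (flog K P) + ι₂ (flog K P)) * jordanian T P := by
  have h1 : jordanian T P * (ι₁ P + ι₂ P) = (ι₁ P * (1 + ι₂ P) + ι₂ P) * jordanian T P := by
    rw [mul_add, jordanian_mul_left 1 (by rw [h, one_smul]), jordanian_mul_right hP rfl, one_smul,
      fexp_flog hP, map_add, map_one, add_mul]
  have z₁ := constantCoeff_mapAlg_eq_zero (inclLeft K L) hP
  have z₂ := constantCoeff_mapAlg_eq_zero (inclRight K L) hP
  rw [mapAlg_flog, mapAlg_flog, ← flog_eq_add z₁ z₂ (commute_left_right P P) rfl]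
  exact (evalSeries_mul_eq_mul_evalSeries _ (by simp [z₁, z₂]) (by simp [z₁, z₂]) h1.symm).symm

/-- A Jordanian factor built on a primitive Borel subalgebra of the twisted algebra. -/
theorem IsTwist.jordanian_mul {F : Uh2 K L} (hF : IsTwist F) {T P : Uh K L}
    (hP : PowerSeries.constantCoeff P = 0) (h : T * P - P * T = P) (hT : IsPrimitiveFor F T)
    (hPF : IsPrimitiveFor F P) (hεT : mapAlg (counit K L) T = 0)
    (hεP : mapAlg (counit K L) P = 0) : IsTwist (jordanian T P * F) := by
  rw [isPrimitiveFor_iff hF.isUnit] at hT hPF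
  have z₁ := constantCoeff_mapAlg_eq_zero (inclLeft K L) hP
  have z₂ := constantCoeff_mapAlg_eq_zero (inclRight K L) hP
  refine hF.fexp_mul (b' := flog K (ι₁ P + ι₂ P)) (constantCoeff_flog P) (constantCoeff_flog _)
    hT ?_ ?_ hεT (by rw [mapAlg_flog, hεP, flog_zero])
  · rw [mapAlg_flog]
    exact (evalSeries_mul_eq_mul_evalSeries _ (by simp [z₁, z₂])
      (constantCoeff_mapAlg_eq_zero _ hP) hPF.symm).symm
  · rw [map_add, mapAlg_comp, mapAlg_comp]
    have key := congrArg (mapAlg (incl23 K L)) (jordanian_mul_flog hP h)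
    simp only [map_mul, map_add, mapAlg_comp, jordanian, mapAlg_fexp, tens_eq,
      incl23_comp_inclLeft] at key
    have c12 : ∀ x y : Uh K L, Commute (κ₁ x : Uh3 K L) (κ₂ y) := fun x y => by
      rw [← mapAlg_comp, ← mapAlg_comp]; exact (commute_left_right x y).map _
    have c13 : ∀ x y : Uh K L, Commute (κ₁ x : Uh3 K L) (κ₃ y) := fun x y => by
      rw [← mapAlg_comp]; exact commute_mapAlg (commute_incl12_incl23 K L) _ y
    have c23 : ∀ x y : Uh K L, Commute (κ₂ x : Uh3 K L) (κ₃ y) := fun x y => by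
      rw [← mapAlg_comp]; exact commute_mapAlg (commute_incl12_incl23 K L) _ y
    exact fexp_jordanian_cocycle (constantCoeff_mapAlg_eq_zero _ (constantCoeff_flog P))
      (constantCoeff_mapAlg_eq_zero _ (constantCoeff_flog P))
      (constantCoeff_mapAlg_eq_zero _ (constantCoeff_flog _)) (c12 _ _) (c12 _ _) (c13 _ _)
      (c23 _ _) (c23 _ _) key

/-- An extension factor `exp (a ⊗ b)` for generators with quasi-primitive twisted coproducts. -/
theorem IsTwist.extension_mul {F : Uh2 K L} (hF : IsTwist F) {a b u v : Uh K L}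
    (hb₀ : PowerSeries.constantCoeff b = 0)
    (ha : F * δ a = (ι₁ a * ι₂ u + ι₂ a) * F) (hb : F * δ b = (ι₁ b + ι₁ v * ι₂ b) * F)
    (hua : Commute u a) (hub : Commute u b) (hva : Commute v a) (h : a * b - b * a = u - v)
    (hεa : mapAlg (counit K L) a = 0) (hεb : mapAlg (counit K L) b = 0) :
    IsTwist (fexp K (tens K (U K L) a b) * F) := by
  have z₁ := constantCoeff_mapAlg_eq_zero (inclLeft K L) hb₀
  have z₂ := constantCoeff_mapAlg_eq_zero (inclRight K L) hb₀
  refine hF.fexp_mul hb₀ (by simp [z₁, z₂]) ha hb ?_ hεa hεb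
  simp only [map_mul, map_add, mapAlg_comp, incl23_comp_inclLeft]
  have c12 : ∀ x y : Uh K L, Commute (κ₁ x : Uh3 K L) (κ₂ y) := fun x y => by
    rw [← mapAlg_comp, ← mapAlg_comp]; exact (commute_left_right x y).map _
  have c13 : ∀ x y : Uh K L, Commute (κ₁ x : Uh3 K L) (κ₃ y) := fun x y => by
    rw [← mapAlg_comp]; exact commute_mapAlg (commute_incl12_incl23 K L) _ y
  have c23 : ∀ x y : Uh K L, Commute (κ₂ x : Uh3 K L) (κ₃ y) := fun x y => by
    rw [← mapAlg_comp]; exact commute_mapAlg (commute_incl12_incl23 K L) _ y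
  exact fexp_extension_cocycle (constantCoeff_mapAlg_eq_zero _ hb₀)
    (constantCoeff_mapAlg_eq_zero _ hb₀) (c12 _ _) (c12 _ _) (c12 _ _) (c13 _ _)
    (c23 _ _) (c23 _ _) (c23 _ _) (c23 _ _) (hua.map _) (hub.map _) (hva.map _)
    (by rw [← map_mul, ← map_mul, ← map_sub, h, map_sub])

end Twist

/-! ### Twists of the extended Borel algebra and the deformed primitive element. -/

section ExtendedBorel

variable {K : Type*} [Field K] {L : Type*} [LieRing L] [LieAlgebra K L]

local notation "ι₁" => mapAlg (inclLeft _ _)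
local notation "ι₂" => mapAlg (inclRight _ _)
local notation "δ" => mapAlg (comul _ _)

/-- `x` is primitive for the untwisted coproduct and is killed by the counit. -/
structure IsGenerator (x : Uh K L) : Prop where
  comul : δ x = ι₁ x + ι₂ x
  counit : mapAlg (counit K L) x = 0

theorem isGenerator_gen (x : L) : IsGenerator (gen K x) where
  comul := by
    ext n
    simp only [gen, mapAlg, PowerSeries.map_C, map_add, PowerSeries.coeff_C]
    split_ifs
    · exact UniversalEnvelopingAlgebra.lift_ι_apply' K _ x
    · simp
  counit := by
    ext n
    simp only [gen, mapAlg, PowerSeries.map_C, PowerSeries.coeff_C]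
    split_ifs
    · exact UniversalEnvelopingAlgebra.lift_ι_apply' K _ x
    · simp

theorem isGenerator_hgen (x : L) : IsGenerator (hgen K x) where
  comul := by
    rw [hgen, map_mul, map_mul, map_mul, (isGenerator_gen x).comul, mul_add]
    simp [mapAlg]
  counit := by
    rw [hgen, map_mul, (isGenerator_gen x).counit, mul_zero]

theorem constantCoeff_hgen (x : L) : PowerSeries.constantCoeff (hgen K x) = 0 := by
  simp [hgen]

attribute [local instance 100] LieRing.ofAssociativeRing in
theorem gen_lie (x y : L) : gen K x * gen K y - gen K y * gen K x = gen K ⁅x, y⁆ := by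
  rw [gen, gen, gen, ← map_mul PowerSeries.C, ← map_mul PowerSeries.C, ← map_sub, LieHom.map_lie,
    LieRing.of_associative_ring_bracket]

theorem gen_hgen_lie (x y : L) : gen K x * hgen K y - hgen K y * gen K x = hgen K ⁅x, y⁆ := by
  rw [hgen, hgen, ← gen_lie, ← mul_assoc, (PowerSeries.commute_X (gen K x)).eq, mul_sub, mul_assoc,
    mul_assoc]

theorem hgen_hgen_lie (x y : L) :
    hgen K x * hgen K y - hgen K y * hgen K x = PowerSeries.X * hgen K ⁅x, y⁆ := by
  rw [hgen, mul_assoc, gen_hgen_lie x y |> sub_eq_iff_eq_add.1, mul_add]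
  rw [← mul_assoc _ (hgen K y), ← (PowerSeries.commute_X (hgen K y)).eq, mul_assoc,
    add_sub_cancel_right]

theorem gen_smul (r : K) (x : L) : gen K (r • x) = r • gen K x := by
  ext n; simp only [gen, map_smul, PowerSeries.coeff_smul, PowerSeries.coeff_C]; split_ifs <;> simp

theorem hgen_smul (r : K) (x : L) : hgen K (r • x) = r • hgen K x := by
  rw [hgen, gen_smul, mul_smul_comm, hgen]

theorem gen_zero : gen K (0 : L) = 0 := by simp [gen]

theorem hgen_zero : hgen K (0 : L) = 0 := by simp [hgen, gen_zero]

theorem hgen_neg (x : L) : hgen K (-x) = -hgen K x := by simp [hgen, gen]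

/-- The relations between the elements `t = H_θ`, `η = H_λ`, `a`, `b`, `p`, `e` of `U(L)[[h]]`
that enter the twists. -/
structure IsBorelExtension (t η a b p e : Uh K L) : Prop where
  gen_t : IsGenerator t
  gen_η : IsGenerator η
  gen_a : IsGenerator a
  gen_b : IsGenerator b
  gen_p : IsGenerator p
  gen_e : IsGenerator e
  b_zero : PowerSeries.constantCoeff b = 0
  p_zero : PowerSeries.constantCoeff p = 0
  e_zero : PowerSeries.constantCoeff e = 0
  t_a : t * a - a * t = (2⁻¹ : K) • a
  t_b : t * b - b * t = (2⁻¹ : K) • b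
  t_p : t * p - p * t = p
  t_e : Commute t e
  η_t : Commute η t
  η_a : η * a - a * η = -((2⁻¹ : K) • a)
  η_b : η * b - b * η = (2⁻¹ : K) • b
  η_p : Commute η p
  η_e : η * e - e * η = e
  a_b : a * b - b * a = p
  a_e : a * e - e * a = -b
  b_e : Commute b e
  p_a : Commute p a
  p_b : Commute p b
  p_e : Commute p e

variable [CharZero K] {t η a b p e : Uh K L}

variable (p) in
/-- `e^{σ/2}` with `σ = ln (1 + p)`. -/
def expHalf : Uh K L := fexp K ((2⁻¹ : K) • flog K p)

variable (p) in
/-- `e^{-σ/2}` with `σ = ln (1 + p)`. -/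
def expNegHalf : Uh K L := fexp K (-((2⁻¹ : K) • flog K p))

theorem commute_expHalf (hp : PowerSeries.constantCoeff p = 0) {y : Uh K L} (hy : Commute p y) :
    Commute (expHalf p) y :=
  (commute_evalSeries (a := (2⁻¹ : K) • flog K p) _ (by simp [constantCoeff_flog])
    ((commute_evalSeries _ hp hy.symm).smul_right _)).symm

theorem commute_expNegHalf (hp : PowerSeries.constantCoeff p = 0) {y : Uh K L}
    (hy : Commute p y) : Commute (expNegHalf p) y :=
  (commute_evalSeries (a := -((2⁻¹ : K) • flog K p)) _ (by simp [constantCoeff_flog])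
    ((commute_evalSeries _ hp hy.symm).smul_right _).neg_right).symm

theorem expHalf_mul_expNegHalf : expHalf p * expNegHalf p = 1 :=
  fexp_mul_fexp_neg (by simp [constantCoeff_flog])

theorem expNegHalf_mul_expHalf : expNegHalf p * expHalf p = 1 := by
  have := fexp_mul_fexp_neg (K := K) (a := -((2⁻¹ : K) • flog K p)) (by simp [constantCoeff_flog])
  rwa [neg_neg] at this

theorem expHalf_mul_self (hp : PowerSeries.constantCoeff p = 0) :
    expHalf p * expHalf p = 1 + p := by
  rw [expHalf, ← fexp_add (by simp [constantCoeff_flog]) (by simp [constantCoeff_flog]) rfl,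
    ← add_smul, ← fexp_flog (K := K) hp]
  norm_num

theorem expNegHalf_mul_self : expNegHalf p * expNegHalf p = fexp K (-flog K p) := by
  rw [expNegHalf, ← fexp_add (by simp [constantCoeff_flog]) (by simp [constantCoeff_flog]) rfl,
    ← neg_add, ← add_smul]
  norm_num

/-- Since `p = e^σ - 1`; this puts `[a, b e^{-σ/2}]` in the form `u - v` required by
`IsTwist.extension_mul`. -/
theorem p_mul_expNegHalf (hp : PowerSeries.constantCoeff p = 0) :
    p * expNegHalf p = expHalf p - expNegHalf p := by
  rw [eq_sub_iff_add_eq, ← add_one_mul, add_comm p, ← expHalf_mul_self hp, mul_assoc,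
    expHalf_mul_expNegHalf, mul_one]

namespace IsBorelExtension

theorem a_b' (h : IsBorelExtension t η a b p e) :
    a * (b * expNegHalf p) - b * expNegHalf p * a = expHalf p - expNegHalf p := by
  have hp : p * expNegHalf p = (a * b - b * a) * expNegHalf p := by rw [h.a_b]
  rw [← p_mul_expNegHalf h.p_zero, hp, mul_assoc b, (commute_expNegHalf h.p_zero h.p_a).eq]
  noncomm_ring

theorem constantCoeff_b' (h : IsBorelExtension t η a b p e) :
    PowerSeries.constantCoeff (b * expNegHalf p) = 0 := by
  rw [map_mul, h.b_zero, zero_mul]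

theorem sq_b' (h : IsBorelExtension t η a b p e) :
    (b * expNegHalf p) ^ 2 = b ^ 2 * fexp K (-flog K p) := by
  rw [((commute_expNegHalf h.p_zero h.p_b).symm).mul_pow, sq (expNegHalf p), expNegHalf_mul_self]

theorem deformed_eq (h : IsBorelExtension t η a b p e) :
    deformed e b p = e + (2⁻¹ : K) • (b * expNegHalf p) ^ 2 := by
  rw [deformed, h.sq_b']

theorem isTwist_jordanian (h : IsBorelExtension t η a b p e) : IsTwist (jordanian t p) := by
  have := isTwist_one.jordanian_mul h.p_zero h.t_p
    ((isPrimitiveFor_iff isUnit_one).2 (by rw [h.gen_t.comul, one_mul, mul_one]))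
    ((isPrimitiveFor_iff isUnit_one).2 (by rw [h.gen_p.comul, one_mul, mul_one]))
    h.gen_t.counit h.gen_p.counit
  rwa [mul_one] at this

theorem jordanian_comul_a (h : IsBorelExtension t η a b p e) :
    jordanian t p * δ a = (ι₁ a * ι₂ (expHalf p) + ι₂ a) * jordanian t p := by
  rw [h.gen_a.comul, mul_add, jordanian_mul_left _ h.t_a, jordanian_mul_right h.p_zero h.p_a,
    add_mul, expHalf]

/-- The twisted coproduct of `b` is `b ⊗ e^{σ/2} + 1 ⊗ b`. Multiplying by the group-like `e^{-σ/2}`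
clears the second leg of the first term and puts `e^{-σ/2}` in the first leg of the other. -/
theorem jordanian_comul_b' (h : IsBorelExtension t η a b p e) :
    jordanian t p * δ (b * expNegHalf p) =
    (ι₁ (b * expNegHalf p) + ι₁ (expNegHalf p) * ι₂ (b * expNegHalf p)) * jordanian t p := by
  have z₁ := constantCoeff_mapAlg_eq_zero (inclLeft K L) (constantCoeff_flog (K := K) p)
  have z₂ := constantCoeff_mapAlg_eq_zero (inclRight K L) (constantCoeff_flog (K := K) p)
  have zδ := constantCoeff_mapAlg_eq_zero (comul K L) (constantCoeff_flog (K := K) p)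
  have hb : jordanian t p * δ b = (ι₁ b * ι₂ (expHalf p) + ι₂ b) * jordanian t p := by
    rw [h.gen_b.comul, mul_add, jordanian_mul_left _ h.t_b, jordanian_mul_right h.p_zero h.p_b,
      add_mul, expHalf]
  have hσ : jordanian t p * δ (flog K p) =
      (ι₁ (flog K p) + ι₂ (flog K p)) * jordanian t p := by
    rw [mapAlg_flog, h.gen_p.comul, jordanian_mul_flog h.p_zero h.t_p]
  have hv : jordanian t p * δ (expNegHalf p) =
      ι₁ (expNegHalf p) * ι₂ (expNegHalf p) * jordanian t p := by
    have e1 : (ι₁ (expNegHalf p) * ι₂ (expNegHalf p) : Uh2 K L) =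
        fexp K (-((2⁻¹ : K) • (ι₁ (flog K p) + ι₂ (flog K p)))) := by
      rw [smul_add, neg_add, fexp_add (by simp [z₁]) (by simp [z₂])
        (((commute_left_right _ _).smul_left _).smul_right _).neg_left.neg_right, expNegHalf,
        mapAlg_fexp, mapAlg_fexp, map_neg, map_neg, mapAlg_smul, mapAlg_smul]
    rw [e1, expNegHalf, mapAlg_fexp, map_neg, mapAlg_smul]
    refine (fexp_mul_eq_mul_fexp (by simp [z₁, z₂]) (by simp [zδ]) ?_).symm
    rw [neg_mul, mul_neg, smul_mul_assoc, mul_smul_comm, hσ]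
  have huv : (ι₂ (expHalf p) * ι₂ (expNegHalf p) : Uh2 K L) = 1 := by
    rw [← map_mul, expHalf_mul_expNegHalf, map_one]
  have e2 : (ι₁ b * ι₂ (expHalf p) * (ι₁ (expNegHalf p) * ι₂ (expNegHalf p)) : Uh2 K L) =
      ι₁ b * ι₁ (expNegHalf p) := by
    rw [mul_assoc, ← mul_assoc (ι₂ (expHalf p)), ← (commute_left_right _ _).eq, mul_assoc, huv,
      mul_one]
  have e3 : (ι₂ b * (ι₁ (expNegHalf p) * ι₂ (expNegHalf p)) : Uh2 K L) =
      ι₁ (expNegHalf p) * (ι₂ b * ι₂ (expNegHalf p)) := by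
    rw [← mul_assoc, ← (commute_left_right _ _).eq, mul_assoc]
  rw [map_mul, ← mul_assoc, hb, mul_assoc, hv, ← mul_assoc, add_mul _ _ (_ * _), e2, e3, map_mul,
    map_mul]

theorem isTwist_extension (h : IsBorelExtension t η a b p e) :
    IsTwist (extensionFactor a b p * jordanian t p) :=
  h.isTwist_jordanian.extension_mul h.constantCoeff_b' h.jordanian_comul_a h.jordanian_comul_b'
    (commute_expHalf h.p_zero h.p_a)
    ((commute_expHalf h.p_zero h.p_b).mul_right
      (commute_expHalf h.p_zero (commute_expNegHalf h.p_zero rfl).symm))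
    (commute_expNegHalf h.p_zero h.p_a) h.a_b' h.gen_a.counit
    (by rw [map_mul, h.gen_b.counit, zero_mul])

theorem η_b' (h : IsBorelExtension t η a b p e) : η * (b * expNegHalf p) - b * expNegHalf p * η =
    (2⁻¹ : K) • (b * expNegHalf p) := by
  rw [mul_assoc b, (commute_expNegHalf h.p_zero h.η_p.symm).eq, ← smul_mul_assoc, ← h.η_b]
  noncomm_ring

/-- `b e^{-σ/2}` has weight `½` under `η`, so its square has weight `1`, like `e`. -/
theorem η_deformed (h : IsBorelExtension t η a b p e) :
    η * deformed e b p - deformed e b p * η = deformed e b p := by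
  have h1 : η * (b * expNegHalf p) ^ 2 - (b * expNegHalf p) ^ 2 * η = (b * expNegHalf p) ^ 2 := by
    have h2 := sub_eq_iff_eq_add.1 h.η_b'
    generalize b * expNegHalf p = c at h2 ⊢
    rw [sq, ← mul_assoc, h2, add_mul, mul_assoc c η, h2, smul_mul_assoc, mul_add,
      mul_smul_comm, ← mul_assoc, ← add_assoc, add_sub_cancel_right, ← add_smul]
    norm_num
  have h3 : η * deformed e b p - deformed e b p * η = (η * e - e * η) +
      (2⁻¹ : K) • (η * (b * expNegHalf p) ^ 2 - (b * expNegHalf p) ^ 2 * η) := by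
    rw [h.deformed_eq, mul_add, add_mul, mul_smul_comm, smul_mul_assoc, smul_sub]
    abel
  rw [h3, h1, h.η_e, h.deformed_eq]

theorem constantCoeff_tens_b' (h : IsBorelExtension t η a b p e) :
    PowerSeries.constantCoeff (tens K (U K L) a (b * expNegHalf p)) = 0 :=
  constantCoeff_mul_right_eq_zero _ (constantCoeff_mapAlg_eq_zero _ h.constantCoeff_b')

/-- `η` commutes with `t` and `p`, and the weights `-½` of `a` and `½` of `b e^{-σ/2}` cancel in `a
⊗ b e^{-σ/2}`. -/
theorem isPrimitiveFor_η (h : IsBorelExtension t η a b p e) :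
    IsPrimitiveFor (extensionFactor a b p * jordanian t p) η := by
  rw [isPrimitiveFor_iff h.isTwist_extension.isUnit, h.gen_η.comul, mul_assoc,
    mul_add (jordanian t p), jordanian_mul_right h.p_zero h.η_p.symm,
    jordanian_mul_left (0 : K) (by rw [zero_smul, h.η_t.eq, sub_self]), zero_smul, fexp_zero,
    map_one, mul_one, ← add_mul, ← mul_assoc, ← mul_assoc]
  congr 1
  refine fexp_mul_commute h.constantCoeff_tens_b' ?_
  have h1 := congrArg (mapAlg (inclLeft K L)) (sub_eq_iff_eq_add.1 h.η_a)
  have h2 := congrArg (mapAlg (inclRight K L)) (sub_eq_iff_eq_add.1 h.η_b')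
  change (ι₁ a * ι₂ (b * expNegHalf p)) * _ = _ * (ι₁ a * ι₂ (b * expNegHalf p))
  have c1 : (ι₁ a * ι₂ (b * expNegHalf p) * ι₁ η : Uh2 K L) =
      ι₁ (a * η) * ι₂ (b * expNegHalf p) := by
    rw [mul_assoc, ← (commute_left_right _ _).eq, ← mul_assoc, ← map_mul]
  have c2 : (ι₂ η * (ι₁ a * ι₂ (b * expNegHalf p)) : Uh2 K L) =
      ι₁ a * ι₂ (η * (b * expNegHalf p)) := by
    rw [← mul_assoc, ← (commute_left_right _ _).eq, mul_assoc, ← map_mul]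
  rw [mul_add, add_mul, c1, c2, h2, ← mul_assoc (ι₁ η), ← map_mul, h1]
  simp only [map_add, map_neg, mapAlg_smul, map_mul, mul_add, add_mul, neg_mul, mul_smul_comm,
    smul_mul_assoc, mul_assoc]
  abel

/-- Conjugating `b' ⊗ 1` adds `(e^{σ/2} - e^{-σ/2}) ⊗ b'`, which flips the sign of the exponent left
by the Jordanian factor. -/
theorem extension_comul_b' (h : IsBorelExtension t η a b p e) :
    extensionFactor a b p * jordanian t p * δ (b * expNegHalf p) =
      (ι₁ (b * expNegHalf p) + ι₁ (expHalf p) * ι₂ (b * expNegHalf p)) *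
        (extensionFactor a b p * jordanian t p) := by
  rw [mul_assoc, h.jordanian_comul_b', ← mul_assoc, ← mul_assoc]
  congr 1
  have hz := h.constantCoeff_tens_b'
  have hva : Commute (expNegHalf p) a := commute_expNegHalf h.p_zero h.p_a
  have hua : Commute (expHalf p) a := commute_expHalf h.p_zero h.p_a
  have c1 : ∀ y : Uh K L, Commute y a → Commute (ι₁ a * ι₂ (b * expNegHalf p) : Uh2 K L)
      (ι₁ y * ι₂ (b * expNegHalf p)) := fun y hy =>
    ((hy.symm.map _).mul_right (commute_left_right _ _)).mul_left
      ((commute_left_right _ _).symm.mul_right (Commute.refl _))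
  have h2 : tens K (U K L) a (b * expNegHalf p) * ι₁ (b * expNegHalf p) =
      ι₁ (b * expNegHalf p) * tens K (U K L) a (b * expNegHalf p) +
        ι₁ (expHalf p - expNegHalf p) * ι₂ (b * expNegHalf p) := by
    rw [← h.a_b', tens_eq, mul_assoc, ← (commute_left_right _ _).eq, ← mul_assoc, ← mul_assoc,
      ← map_mul, ← map_mul, map_sub, sub_mul]
    abel
  have key := fexp_mul_of_commutator (K := K) hz h2 (w := 0)
    (by rw [add_zero, tens_eq, (c1 _ (hua.sub_left hva)).eq]) (by simp)
  rw [extensionFactor, mul_add]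
  change fexp K (tens K (U K L) a (b * expNegHalf p)) * _ +
    fexp K (tens K (U K L) a (b * expNegHalf p)) * _ =
      _ * fexp K (tens K (U K L) a (b * expNegHalf p))
  rw [key, fexp_mul_commute hz (c1 _ hva), ← add_mul, map_sub]
  congr 1
  rw [smul_zero]
  noncomm_ring

/-- The Jordanian factor leaves `Δ e` alone. Commuting `a ⊗ b'` with `e ⊗ 1` follows the string:
first `-b ⊗ b'`, then `-p ⊗ b'²`, then `0`. -/
theorem extension_comul_e (h : IsBorelExtension t η a b p e) :
    extensionFactor a b p * jordanian t p * δ e =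
      (ι₁ e + ι₂ e - ι₁ b * ι₂ (b * expNegHalf p) -
        (2⁻¹ : K) • (ι₁ p * ι₂ ((b * expNegHalf p) ^ 2))) *
        (extensionFactor a b p * jordanian t p) := by
  rw [h.gen_e.comul, mul_assoc, mul_add (jordanian t p),
    jordanian_mul_right h.p_zero h.p_e,
    jordanian_mul_left (0 : K) (by rw [zero_smul, h.t_e.eq, sub_self]), zero_smul, fexp_zero,
    map_one, mul_one, ← add_mul, ← mul_assoc, ← mul_assoc]
  congr 1
  have hz := h.constantCoeff_tens_b'
  have hy : tens K (U K L) a (b * expNegHalf p) * ι₁ e =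
      ι₁ e * tens K (U K L) a (b * expNegHalf p) + -(ι₁ b * ι₂ (b * expNegHalf p)) := by
    rw [tens_eq, mul_assoc, ← (commute_left_right _ _).eq, ← mul_assoc, ← mul_assoc,
      ← map_mul, ← map_mul, sub_eq_iff_eq_add.1 h.a_e, map_add, map_neg, add_mul, neg_mul]
    abel
  have hw : tens K (U K L) a (b * expNegHalf p) * -(ι₁ b * ι₂ (b * expNegHalf p)) =
      -(ι₁ b * ι₂ (b * expNegHalf p)) * tens K (U K L) a (b * expNegHalf p) +
        -(ι₁ p * ι₂ ((b * expNegHalf p) ^ 2)) := by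
    have e1 : ∀ x y : Uh K L, (ι₁ x * ι₂ (b * expNegHalf p) * (ι₁ y * ι₂ (b * expNegHalf p)) :
        Uh2 K L) = ι₁ (x * y) * ι₂ ((b * expNegHalf p) ^ 2) := fun x y => by
      rw [mul_assoc, ← mul_assoc (ι₂ (b * expNegHalf p)), ← (commute_left_right _ _).eq, sq,
        map_mul (ι₁) x, map_mul (ι₂) (b * expNegHalf p)]
      simp only [mul_assoc]
    rw [tens_eq, mul_neg, neg_mul, e1, e1, sub_eq_iff_eq_add.1 h.a_b, map_add, add_mul]
    abel
  have hc : Commute (tens K (U K L) a (b * expNegHalf p))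
      (-(ι₁ p * ι₂ ((b * expNegHalf p) ^ 2))) := by
    rw [tens_eq]
    exact (((h.p_a.symm.map _).mul_right (commute_left_right _ _)).mul_left
      ((commute_left_right _ _).symm.mul_right (((Commute.refl _).pow_right 2).map _))).neg_right
  have hbe : Commute (b * expNegHalf p) e :=
    h.b_e.mul_left (commute_expNegHalf h.p_zero h.p_e)
  have he : Commute (tens K (U K L) a (b * expNegHalf p)) (ι₂ e) := by
    rw [tens_eq]
    exact (commute_left_right _ _).mul_left (hbe.map _)
  have key := fexp_mul_of_commutator (K := K) hz hy hw hc.eq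
  rw [extensionFactor, mul_add]
  change fexp K (tens K (U K L) a (b * expNegHalf p)) * _ +
    fexp K (tens K (U K L) a (b * expNegHalf p)) * _ =
      _ * fexp K (tens K (U K L) a (b * expNegHalf p))
  rw [key, fexp_mul_commute hz he, ← add_mul, smul_neg]
  congr 1
  abel

theorem isPrimitiveFor_deformed (h : IsBorelExtension t η a b p e) :
    IsPrimitiveFor (extensionFactor a b p * jordanian t p) (deformed e b p) := by
  rw [isPrimitiveFor_iff h.isTwist_extension.isUnit, h.deformed_eq, map_add, mapAlg_smul, mul_add,
    h.extension_comul_e, mul_smul_comm, sq, map_mul (δ) (b * expNegHalf p),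
    ← mul_assoc (extensionFactor a b p * jordanian t p), h.extension_comul_b',
    mul_assoc _ (_ * _) (δ _), h.extension_comul_b', ← mul_assoc _ _ (_ * _),
    ← smul_mul_assoc _ _ (extensionFactor a b p * jordanian t p),
    ← add_mul]
  congr 1
  have hcu : Commute (b * expNegHalf p) (expHalf p) :=
    ((commute_expHalf h.p_zero h.p_b).mul_right
      (commute_expHalf h.p_zero (commute_expNegHalf h.p_zero rfl).symm)).symm
  have hbu : b * expNegHalf p * expHalf p = b := by
    rw [mul_assoc, expNegHalf_mul_expHalf, mul_one]
  set c := b * expNegHalf p with hc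
  -- Half of this square contains `b ⊗ c + ½ p ⊗ c²`, exactly the defect of `e` with opposite sign.
  have e1 : ((ι₁ c + ι₁ (expHalf p) * ι₂ c) * (ι₁ c + ι₁ (expHalf p) * ι₂ c) : Uh2 K L) =
      ι₁ (c * c) + (2 : K) • (ι₁ b * ι₂ c) + ι₁ (1 + p) * ι₂ (c * c) := by
    have f1 : (ι₁ c * (ι₁ (expHalf p) * ι₂ c) : Uh2 K L) = ι₁ b * ι₂ c := by
      rw [← mul_assoc, ← map_mul, hbu]
    have f2 : (ι₁ (expHalf p) * ι₂ c * ι₁ c : Uh2 K L) = ι₁ b * ι₂ c := by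
      rw [mul_assoc, ← (commute_left_right _ _).eq, ← mul_assoc, ← map_mul, ← hcu.eq, hbu]
    have f3 : (ι₁ (expHalf p) * ι₂ c * (ι₁ (expHalf p) * ι₂ c) : Uh2 K L) =
        ι₁ (1 + p) * ι₂ (c * c) := by
      rw [mul_assoc, ← mul_assoc (ι₂ c), ← (commute_left_right _ _).eq, mul_assoc, ← mul_assoc,
        ← map_mul, ← map_mul, expHalf_mul_self h.p_zero]
    rw [mul_add, add_mul, add_mul, f1, f2, f3, two_smul, map_mul (ι₁) c]
    abel
  rw [e1, map_add (ι₁) 1 p, map_one, add_mul 1, one_mul, smul_add, smul_add, smul_smul,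
    inv_mul_cancel₀ two_ne_zero, one_smul, smul_add, map_add, map_add, mapAlg_smul, mapAlg_smul]
  abel

theorem isTwist_composite (h : IsBorelExtension t η a b p e) :
    IsTwist (jordanian η (deformed e b p) * extensionFactor a b p * jordanian t p) := by
  rw [mul_assoc]
  refine h.isTwist_extension.jordanian_mul ?_ h.η_deformed h.isPrimitiveFor_η
    h.isPrimitiveFor_deformed h.gen_η.counit ?_
  · simp [deformed, h.e_zero, h.b_zero]
  · rw [deformed, map_add, mapAlg_smul, map_mul, map_pow, h.gen_b.counit, h.gen_e.counit]
    simp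

end IsBorelExtension

end ExtendedBorel

/-! ### Elementary facts on roots and the Cartan subalgebra. -/

section Weights

open LieAlgebra LieAlgebra.IsKilling LieModule

variable {K : Type*} [Field K] {L : Type*} [LieRing L] [LieAlgebra K L]
  {H : LieSubalgebra K L} [H.IsCartanSubalgebra]

theorem isRoot_weight {α : Weight K H L} : IsRoot H α ↔ α.IsNonZero := by
  constructor
  · rintro ⟨γ, hγ, e⟩
    rwa [← DFunLike.coe_injective e]
  · exact fun h => ⟨α, h, rfl⟩

theorem isNonZero_of_apply_ne_zero {γ : Weight K H L} {x : H} (h : γ x ≠ 0) : γ.IsNonZero :=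
  fun e => h (by rw [e.eq]; rfl)

theorem IsCoincidentTriple.θ_eq {lam θ μ : Weight K H L} (h : IsCoincidentTriple lam θ μ) :
    (θ : H → K) = lam + (2 : K) • (μ : H → K) := by
  have := h.coincide
  ext x
  have := congrFun this x
  simp only [Pi.add_apply, Pi.sub_apply, Pi.neg_apply, Pi.smul_apply, smul_eq_mul] at this ⊢
  linear_combination -this

theorem cartanGen_lie_cartanGen [CharZero K] [FiniteDimensional K L] [IsKilling K L]
    [IsTriangularizable K H L] (α β : Weight K H L) : ⁅cartanGen α, cartanGen β⁆ = 0 := by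
  rw [cartanGen, cartanGen, smul_lie, lie_smul, ← LieSubalgebra.coe_bracket, trivial_lie_zero]
  simp

end Weights

/-! ### Root combinatorics: reduction to a `C₂` subsystem and its brackets. -/

section RootCombinatorics

open LieAlgebra LieAlgebra.IsKilling LieModule

variable {K : Type*} [Field K] [CharZero K] {L : Type*} [LieRing L] [LieAlgebra K L]
  [FiniteDimensional K L] [IsKilling K L]
  {H : LieSubalgebra K L} [H.IsCartanSubalgebra] [IsTriangularizable K H L]

/-- A non-zero weight as an element of the index set of the root system. -/
def rootIndex (α : Weight K H L) (hα : α.IsNonZero) : H.root := ⟨α, by simpa using hα⟩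

theorem pairingIn_cast (i j : H.root) :
    (((rootSystem H).pairingIn ℤ i j : ℤ) : K) = i.1 (coroot j.1) := by
  rw [← rootSystem_pairing_apply, ← (rootSystem H).algebraMap_pairingIn ℤ]
  simp

theorem exists_int_apply_coroot {α β : Weight K H L} (hα : α.IsNonZero) (hβ : β.IsNonZero) :
    ∃ m n : ℤ, α (coroot β) = m ∧ β (coroot α) = n ∧
      (m, n) ∈ ({(0, 0), (1, 1), (-1, -1), (1, 2), (2, 1), (-1, -2), (-2, -1), (1, 3), (3, 1),
        (-1, -3), (-3, -1), (2, 2), (-2, -2)} : Set (ℤ × ℤ)) :=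
  ⟨_, _, (pairingIn_cast (rootIndex α hα) (rootIndex β hβ)).symm,
    (pairingIn_cast (rootIndex β hβ) (rootIndex α hα)).symm,
    (rootSystem H).pairingIn_pairingIn_mem_set_of_isCrystal_of_isRed _ _⟩

theorem exists_int_apply_coroot_of_ne {α β : Weight K H L} (hα : α.IsNonZero)
    (hβ : β.IsNonZero) (h : (α : H → K) ≠ β) (h' : (α : H → K) ≠ -β) :
    ∃ m n : ℤ, α (coroot β) = m ∧ β (coroot α) = n ∧
      (m, n) ∈ ({(0, 0), (1, 1), (-1, -1), (1, 2), (2, 1), (-1, -2), (-2, -1), (1, 3), (3, 1),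
        (-1, -3), (-3, -1)} : Set (ℤ × ℤ)) :=
  ⟨_, _, (pairingIn_cast (rootIndex α hα) (rootIndex β hβ)).symm,
    (pairingIn_cast (rootIndex β hβ) (rootIndex α hα)).symm,
    (rootSystem H).pairingIn_pairingIn_mem_set_of_isCrystal_of_isRed' _ _
      (fun e => h (by ext x; exact DFunLike.congr_fun e x))
      (fun e => h' (by ext x; exact DFunLike.congr_fun e x))⟩

theorem exists_abs_le_three_apply_coroot {α β : Weight K H L} (hα : α.IsNonZero)
    (hβ : β.IsNonZero) : ∃ m : ℤ, α (coroot β) = m ∧ -3 ≤ m ∧ m ≤ 3 := by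
  obtain ⟨m, n, hm, -, h⟩ := exists_int_apply_coroot hα hβ
  refine ⟨m, hm, ?_⟩
  simp only [Set.mem_insert_iff, Set.mem_singleton_iff, Prod.mk.injEq] at h
  omega

theorem coroot_reflectRoot {α β : Weight K H L} (hα : α.IsNonZero) (hβ : β.IsNonZero) :
    coroot (reflectRoot α β) = coroot β - α (coroot β) • coroot α := by
  have e : rootIndex (reflectRoot α β) (reflectRoot_isNonZero α β hβ) =
      (rootSystem H).reflectionPerm (rootIndex α hα) (rootIndex β hβ) := by
    apply (rootSystem H).root.injective
    rw [RootPairing.root_reflectionPerm, RootPairing.reflection_apply_root]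
    ext x
    simp [rootIndex, reflectRoot]
  have e' : coroot (reflectRoot α β) = (rootSystem H).coroot
      ((rootSystem H).reflectionPerm (rootIndex α hα) (rootIndex β hβ)) := by
    rw [← e]; rfl
  rw [e', RootPairing.coroot_reflectionPerm, RootPairing.coreflection_apply_coroot]
  rfl

theorem apply_coroot_reflectRoot {α β : Weight K H L} (hα : α.IsNonZero) (hβ : β.IsNonZero)
    (γ : Weight K H L) :
    γ (coroot (reflectRoot α β)) = γ (coroot β) - α (coroot β) * γ (coroot α) := by
  rw [coroot_reflectRoot hα hβ, map_sub, map_smul, smul_eq_mul]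

/-- Cartan integers are at most `3` in absolute value. Every vanishing root space needed below is
detected by a value `±4` on a suitable coroot. -/
theorem rootSpace_eq_bot_of_apply_coroot {β : Weight K H L} (hβ : β.IsNonZero) {χ : H → K}
    (h : χ (coroot β) = 4 ∨ χ (coroot β) = -4) : rootSpace H χ = ⊥ := by
  by_contra hne
  let γ : Weight K H L := ⟨χ, hne⟩
  have hγ : γ.IsNonZero := isNonZero_of_apply_ne_zero (x := coroot β) (by
    change χ _ ≠ 0
    rcases h with h | h <;> rw [h] <;> norm_num)
  obtain ⟨m, hm, h1, h2⟩ := exists_abs_le_three_apply_coroot hγ hβ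
  change χ _ = _ at hm
  rw [hm] at h
  have : m = 4 ∨ m = -4 := by exact_mod_cast h
  omega

theorem not_isRoot_of_apply_coroot {β : Weight K H L} (hβ : β.IsNonZero) {χ : H → K}
    (h : χ (coroot β) = 4 ∨ χ (coroot β) = -4) : ¬ IsRoot H χ := by
  rintro ⟨γ, -, rfl⟩
  exact γ.genWeightSpace_ne_bot' (rootSpace_eq_bot_of_apply_coroot hβ h)

theorem lie_eq_zero_of_apply_coroot {β : Weight K H L} (hβ : β.IsNonZero) {χ₁ χ₂ : H → K}
    (h : (χ₁ + χ₂) (coroot β) = 4 ∨ (χ₁ + χ₂) (coroot β) = -4) {x y : L}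
    (hx : x ∈ rootSpace H χ₁) (hy : y ∈ rootSpace H χ₂) : ⁅x, y⁆ = 0 := by
  have := lie_mem_genWeightSpace_of_mem_genWeightSpace hx hy
  change _ ∈ rootSpace H (χ₁ + χ₂) at this
  rwa [rootSpace_eq_bot_of_apply_coroot hβ h, LieSubmodule.mem_bot] at this

theorem cartanGen_lie (α : Weight K H L) {χ : H → K} {x : L} (hx : x ∈ rootSpace H χ) :
    ⁅cartanGen α, x⁆ = (2⁻¹ * χ (coroot α) : K) • x := by
  have := lie_eq_smul_of_mem_rootSpace hx (coroot α)
  rw [cartanGen, smul_lie, mul_smul, ← this]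
  rfl

/-- The roots `lam` and `μ` are adjacent nodes of a subsystem of type `C₂`, with `lam` long. -/
structure IsLongShort (lam μ : Weight K H L) : Prop where
  lam_ne : lam.IsNonZero
  μ_ne : μ.IsNonZero
  lam_μ : lam (coroot μ) = -2
  μ_lam : μ (coroot lam) = -1

namespace IsLongShort

variable {lam μ : Weight K H L}
-- `reflectRoot lam μ` is the middle root `lam + μ` of the string; its coroot serves as the test
-- element.
theorem isNonZero_sum (h : IsLongShort lam μ) : (reflectRoot lam μ).IsNonZero :=
  reflectRoot_isNonZero _ _ h.μ_ne

theorem lam_coroot_sum (h : IsLongShort lam μ) : lam (coroot (reflectRoot lam μ)) = 2 := by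
  rw [apply_coroot_reflectRoot h.lam_ne h.μ_ne, h.lam_μ, root_apply_coroot h.lam_ne]; norm_num

theorem μ_coroot_sum (h : IsLongShort lam μ) : μ (coroot (reflectRoot lam μ)) = 0 := by
  rw [apply_coroot_reflectRoot h.lam_ne h.μ_ne, h.lam_μ, h.μ_lam, root_apply_coroot h.μ_ne]
  norm_num

end IsLongShort

theorem IsCoincidentTriple.isLongShort {lam θ μ : Weight K H L}
    (h : IsCoincidentTriple lam θ μ) : IsLongShort lam μ := by
  have hlam : lam.IsNonZero := isRoot_weight.1 h.lam_root
  have hθ : θ.IsNonZero := isRoot_weight.1 h.θ_root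
  have hμ : μ.IsNonZero := isRoot_weight.1 h.constituent.root
  have hθe := h.θ_eq
  have hθx : ∀ x, θ x = lam x + 2 * μ x := fun x => by rw [hθe]; rfl
  have hne : (lam : H → K) ≠ μ := fun e => by
    refine not_isRoot_of_apply_coroot hμ (Or.inl ?_) h.constituent.root_sub
    rw [Pi.sub_apply, hθx, e, root_apply_coroot hμ]
    norm_num
  have hne' : (lam : H → K) ≠ -μ := fun e => by
    obtain ⟨γ, hγ, hγe⟩ := h.constituent.root_sub
    refine hγ ?_
    ext x
    rw [hγe, Pi.sub_apply, hθx, e, Pi.neg_apply]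
    simp only [Pi.zero_apply]
    ring
  obtain ⟨m, n, hm, hn, hmn⟩ := exists_int_apply_coroot_of_ne hlam hμ hne hne'
  -- The root `θ = lam + 2μ` takes the values `m + 4` and `2 + 2n` on the two coroots, so `m ≤ -1`
  -- and `n ≥ -2`. Of the list only `(-1,-1)`, `(-1,-2)`, `(-2,-1)`, `(-3,-1)` survive.
  obtain ⟨k, hk, hk1, hk2⟩ := exists_abs_le_three_apply_coroot hθ hμ
  obtain ⟨l, hl, hl1, hl2⟩ := exists_abs_le_three_apply_coroot hθ hlam
  rw [hθx, hm, root_apply_coroot hμ] at hk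
  rw [hθx, hn, root_apply_coroot hlam] at hl
  have hk' : m + 2 * 2 = k := by exact_mod_cast hk
  have hl' : 2 + 2 * n = l := by exact_mod_cast hl
  -- Here reflecting `lam` in `μ` would make `lam + 3μ = μ + θ` a root.
  have hm3 : m ≠ -3 := by
    rintro rfl
    refine h.constituent.not_root_add ⟨reflectRoot μ lam, reflectRoot_isNonZero _ _ hlam, ?_⟩
    ext x
    change lam x - lam (coroot μ) * μ x = μ x + θ x
    rw [hm, hθx]; push_cast; ring
  have hn2 : n ≠ -2 := by
    rintro rfl
    refine h.short ⟨reflectRoot lam μ, reflectRoot_isNonZero _ _ hμ, ?_⟩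
    ext x
    change μ x - μ (coroot lam) * lam x = μ x + 2 • lam x
    rw [hn, nsmul_eq_mul]; push_cast; ring
  -- With `ν = lam + μ` a root, `θ` takes the value `3` on its coroot, so `-(θ - 3ν) = μ + 2 lam`
  -- would be a root.
  have h11 : ¬ (m = -1 ∧ n = -1) := by
    rintro ⟨rfl, rfl⟩
    have hν := reflectRoot_isNonZero lam μ hμ
    have hθν : θ (coroot (reflectRoot lam μ)) = 3 := by
      rw [apply_coroot_reflectRoot hlam hμ, hθx, hθx, hm, hn, root_apply_coroot hμ,
        root_apply_coroot hlam]
      norm_num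
    refine h.short ⟨-reflectRoot (reflectRoot lam μ) θ,
      (reflectRoot_isNonZero _ _ hθ).neg, ?_⟩
    ext x
    change -(θ x - θ (coroot (reflectRoot lam μ)) * (μ x - μ (coroot lam) * lam x)) =
      μ x + 2 • lam x
    rw [hθν, hn, hθx, nsmul_eq_mul]; push_cast; ring
  have : m = -2 ∧ n = -1 := by
    simp only [Set.mem_insert_iff, Set.mem_singleton_iff, Prod.mk.injEq] at hmn
    omega
  obtain ⟨rfl, rfl⟩ := this
  exact ⟨hlam, hμ, by rw [hm]; norm_num, by rw [hn]; norm_num⟩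

namespace IsLongShort

variable {lam θ μ : Weight K H L}

theorem reflectRoot_eq (h : IsLongShort lam μ) (hθ : (θ : H → K) = lam + (2 : K) • (μ : H → K)) :
    reflectRoot μ lam = θ := by
  apply DFunLike.coe_injective
  rw [hθ]
  ext x
  change lam x - lam (coroot μ) * μ x = lam x + 2 * μ x
  rw [h.lam_μ]; ring

theorem apply_coroot_θ (h : IsLongShort lam μ)
    (hθ : (θ : H → K) = lam + (2 : K) • (μ : H → K)) (γ : Weight K H L) :
    γ (coroot θ) = γ (coroot lam) + γ (coroot μ) := by
  rw [← h.reflectRoot_eq hθ, apply_coroot_reflectRoot h.μ_ne h.lam_ne, h.μ_lam]; ring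

theorem isCoincidentTriple (h : IsLongShort lam μ) :
    IsCoincidentTriple lam (reflectRoot μ lam) μ := by
  have hx : ∀ x, reflectRoot μ lam x = lam x + 2 * μ x := fun x => by
    change lam x - lam (coroot μ) * μ x = _
    rw [h.lam_μ]; ring
  refine ⟨isRoot_weight.2 h.lam_ne, isRoot_weight.2 (reflectRoot_isNonZero _ _ h.lam_ne),
    ⟨isRoot_weight.2 h.μ_ne, ⟨reflectRoot lam μ, h.isNonZero_sum, ?_⟩, ?_, ?_⟩, ?_, ?_⟩
  · ext x
    rw [Pi.sub_apply, hx]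
    change μ x - μ (coroot lam) * lam x = _
    rw [h.μ_lam]; ring
  · refine not_isRoot_of_apply_coroot h.μ_ne (Or.inl ?_)
    rw [Pi.add_apply, hx, h.lam_μ, root_apply_coroot h.μ_ne]; norm_num
  · refine not_isRoot_of_apply_coroot h.isNonZero_sum (Or.inl ?_)
    rw [Pi.add_apply, Pi.sub_apply, hx, h.lam_coroot_sum, h.μ_coroot_sum]; norm_num
  · ext x
    simp only [Pi.add_apply, Pi.sub_apply, Pi.neg_apply, hx]; ring
  · refine not_isRoot_of_apply_coroot h.isNonZero_sum (Or.inl ?_)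
    rw [Pi.add_apply, Pi.smul_apply, h.lam_coroot_sum, h.μ_coroot_sum]; norm_num

/-- `E` is a lowest weight vector of weight `-2` for the `sl₂` of `μ`. Applying `f` to `[A, E]` and
`[A, [A, E]]` returns twice the previous vector, so neither vanishes. -/
theorem exists_isNormalized (h : IsLongShort lam μ)
    (hθ : (θ : H → K) = lam + (2 : K) • (μ : H → K)) :
    ∃ E P A B : L, IsNormalized lam θ μ E P A B := by
  obtain ⟨c, A, f, ht, hA, hf⟩ := exists_isSl2Triple_of_weight_isNonZero h.μ_ne
  have hc := ht.h_eq_coroot h.μ_ne hA hf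
  obtain ⟨E, hE : E ∈ rootSpace H lam, hE0⟩ := lam.exists_ne_zero
  have hθx : ∀ x, θ x = lam x + 2 * μ x := fun x => by rw [hθ]; rfl
  have hB : ⁅A, E⁆ ∈ rootSpace H (θ - μ : H → K) := by
    have := lie_mem_genWeightSpace_of_mem_genWeightSpace hA hE
    convert this using 2
    ext x
    simp only [Pi.sub_apply, Pi.add_apply, hθx]; ring
  have hP : ⁅A, ⁅A, E⁆⁆ ∈ rootSpace H θ := by
    have := lie_mem_genWeightSpace_of_mem_genWeightSpace hA hB
    convert this using 2
    ext x
    simp only [Pi.sub_apply, Pi.add_apply]; ring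
  have hcE : ⁅c, E⁆ = (-2 : K) • E := by
    have := lie_eq_smul_of_mem_rootSpace hE (coroot μ)
    rw [h.lam_μ] at this
    rw [hc, ← this]; rfl
  have hcB : ⁅c, ⁅A, E⁆⁆ = 0 := by
    have := lie_eq_smul_of_mem_rootSpace hB (coroot μ)
    rw [Pi.sub_apply, hθx, h.lam_μ, root_apply_coroot h.μ_ne] at this
    norm_num at this
    rw [hc]; exact this
  have hfE : ⁅f, E⁆ = 0 := by
    refine lie_eq_zero_of_apply_coroot h.μ_ne (Or.inr ?_) hf hE
    rw [Pi.add_apply, Pi.neg_apply, h.lam_μ, root_apply_coroot h.μ_ne]; norm_num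
  have hfA : ⁅f, A⁆ = -c := by rw [← ht.lie_e_f, lie_skew]
  have hfB : ⁅f, ⁅A, E⁆⁆ = (2 : K) • E := by
    rw [leibniz_lie, hfE, lie_zero, add_zero, hfA, neg_lie, hcE, ← neg_smul, neg_neg]
  have hfP : ⁅f, ⁅A, ⁅A, E⁆⁆⁆ = (2 : K) • ⁅A, E⁆ := by
    rw [leibniz_lie, hfB, hfA, neg_lie, hcB, neg_zero, zero_add, lie_smul]
  have hB0 : ⁅A, E⁆ ≠ 0 := fun e => by
    rw [e, lie_zero] at hfB
    exact (smul_ne_zero two_ne_zero hE0) hfB.symm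
  have hP0 : ⁅A, ⁅A, E⁆⁆ ≠ 0 := fun e => by
    rw [e, lie_zero] at hfP
    exact (smul_ne_zero two_ne_zero hB0) hfP.symm
  refine ⟨E, -⁅A, ⁅A, E⁆⁆, A, -⁅A, E⁆, hE, neg_mem hP, hA, neg_mem hB, hE0, neg_ne_zero.2 hP0,
    ht.e_ne_zero, neg_ne_zero.2 hB0, lie_neg _ _, (neg_neg _).symm⟩

theorem isBorelExtension (h : IsLongShort lam μ)
    (hθ : (θ : H → K) = lam + (2 : K) • (μ : H → K)) {E P A B : L}
    (hn : IsNormalized lam θ μ E P A B) :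
    IsBorelExtension (gen K (cartanGen θ)) (gen K (cartanGen lam)) (gen K A) (hgen K B)
      (hgen K P) (hgen K E) := by
  have hθx : ∀ x, θ x = lam x + 2 * μ x := fun x => by rw [hθ]; rfl
  have hΘ := h.apply_coroot_θ hθ
  have hll := root_apply_coroot h.lam_ne
  have hμμ := root_apply_coroot h.μ_ne
  have hlm := h.lam_μ
  have hml := h.μ_lam
  have hls := h.lam_coroot_sum
  have hms := h.μ_coroot_sum
  have hne := h.isNonZero_sum
  -- `μ + θ` takes the value `4` on the coroot of `μ`. On the coroot of `lam + μ` each of `lam`,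
  -- `θ`, `θ - μ` takes the value `2`, so any two add up to `4`.
  have hPA : ⁅A, P⁆ = 0 := lie_eq_zero_of_apply_coroot h.μ_ne
    (Or.inl (by rw [Pi.add_apply, hθx, hlm, hμμ]; norm_num)) hn.A_mem hn.P_mem
  have hPB : ⁅P, B⁆ = 0 := lie_eq_zero_of_apply_coroot hne
    (Or.inl (by rw [Pi.add_apply, Pi.sub_apply, hθx, hls, hms]; norm_num)) hn.P_mem hn.B_mem
  have hPE : ⁅P, E⁆ = 0 := lie_eq_zero_of_apply_coroot hne
    (Or.inl (by rw [Pi.add_apply, hθx, hls, hms]; norm_num)) hn.P_mem hn.E_mem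
  have hBE : ⁅B, E⁆ = 0 := lie_eq_zero_of_apply_coroot hne
    (Or.inl (by rw [Pi.add_apply, Pi.sub_apply, hθx, hls, hms]; norm_num)) hn.B_mem hn.E_mem
  have com : ∀ {x y : Uh K L}, x * y - y * x = 0 → Commute x y := fun e => sub_eq_zero.1 e
  refine ⟨isGenerator_gen _, isGenerator_gen _, isGenerator_gen _, isGenerator_hgen _,
    isGenerator_hgen _, isGenerator_hgen _, constantCoeff_hgen _, constantCoeff_hgen _,
    constantCoeff_hgen _, ?_, ?_, ?_, com ?_, com ?_, ?_, ?_, com ?_, ?_, ?_, ?_, com ?_,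
    (com ?_ : Commute (gen K A) (hgen K P)).symm, com ?_, com ?_⟩
  · rw [gen_lie, cartanGen_lie θ hn.A_mem, hΘ, hml, hμμ, ← gen_smul]; norm_num
  · rw [gen_hgen_lie, cartanGen_lie θ hn.B_mem, Pi.sub_apply, hθx, hΘ, hΘ, hml, hμμ, hll, hlm,
      ← hgen_smul]; norm_num
  · rw [gen_hgen_lie, cartanGen_lie θ hn.P_mem, hθx, hΘ, hΘ, hml, hμμ, hll, hlm]; norm_num
  · rw [gen_hgen_lie, cartanGen_lie θ hn.E_mem, hΘ, hll, hlm]; norm_num [hgen_zero]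
  · rw [gen_lie, cartanGen_lie_cartanGen, gen_zero]
  · rw [gen_lie, cartanGen_lie lam hn.A_mem, hml, ← neg_smul, ← gen_smul]; norm_num
  · rw [gen_hgen_lie, cartanGen_lie lam hn.B_mem, Pi.sub_apply, hθx, hml, hll, ← hgen_smul]
    norm_num
  · rw [gen_hgen_lie, cartanGen_lie lam hn.P_mem, hθx, hml, hll]; norm_num [hgen_zero]
  · rw [gen_hgen_lie, cartanGen_lie lam hn.E_mem, hll]; norm_num
  · rw [gen_hgen_lie, hn.lie_A_B]
  · rw [gen_hgen_lie, hn.lie_A_E, hgen_neg]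
  · rw [hgen_hgen_lie, hBE, hgen_zero, mul_zero]
  · rw [gen_hgen_lie, hPA, hgen_zero]
  · rw [hgen_hgen_lie, hPB, hgen_zero, mul_zero]
  · rw [hgen_hgen_lie, hPE, hgen_zero, mul_zero]

end IsLongShort

theorem exists_isCoincidentTriple_of_cartanMatrix {n : ℕ} {M : Matrix (Fin n) (Fin n) ℤ}
    (hM : HasCartanMatrix H M) {i j : Fin n} (hij : M i j = -2) (hji : M j i = -1) :
    ∃ lam θ μ : Weight K H L, IsCoincidentTriple lam θ μ := by
  obtain ⟨b, e, he⟩ := hM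
  have h1 := pairingIn_cast (e.symm i).1 (e.symm j).1
  have h2 := pairingIn_cast (e.symm j).1 (e.symm i).1
  have h3 := he (e.symm i) (e.symm j)
  have h4 := he (e.symm j) (e.symm i)
  rw [RootPairing.Base.cartanMatrix, RootPairing.Base.cartanMatrixIn_def] at h3 h4
  rw [h3, e.apply_symm_apply, e.apply_symm_apply, hij] at h1
  rw [h4, e.apply_symm_apply, e.apply_symm_apply, hji] at h2
  have h : IsLongShort (e.symm i).1.1 (e.symm j).1.1 :=
    ⟨H.isNonZero_coe_root _, H.isNonZero_coe_root _, by rw [← h1]; norm_num,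
      by rw [← h2]; norm_num⟩
  exact ⟨_, _, _, h.isCoincidentTriple⟩

end RootCombinatorics

end JordanianTwist

end

/-! ### The main theorem. -/

open JordanianTwist in
theorem mainTheorem2 {K : Type*} [Field K] [CharZero K] {L : Type*} [LieRing L] [LieAlgebra K L]
    [FiniteDimensional K L] [LieAlgebra.IsKilling K L]
    (H : LieSubalgebra K L) [H.IsCartanSubalgebra] [LieModule.IsTriangularizable K H L] :
    (∀ lam θ μ : LieModule.Weight K H L, IsCoincidentTriple lam θ μ →
      -- the coincidence relation, and the long series `θ, θ - μ, θ - 2μ` of roots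
      ((μ : H → K) + lam = θ - μ ∧
        IsRoot H θ ∧ IsRoot H (θ - μ) ∧ IsRoot H (θ - 2 • (μ : H → K))) ∧
      -- the normalization can be achieved
      (∃ E P A B : L, IsNormalized lam θ μ E P A B) ∧
      (∀ E P A B : L, IsNormalized lam θ μ E P A B →
        let Hlam : Uh K L := gen K (cartanGen lam)
        let EBO : Uh K L := deformed (hgen K E) (hgen K B) (hgen K P)
        let ΦJ : Uh2 K L := jordanian (gen K (cartanGen θ)) (hgen K P)
        let ΦE : Uh2 K L := extensionFactor (gen K A) (hgen K B) (hgen K P)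
        let ΦBJ : Uh2 K L := jordanian Hlam EBO
        -- the deformed primitive Borel subalgebra of the twisted enveloping algebra
        IsTwist (ΦE * ΦJ) ∧
        Hlam * EBO - EBO * Hlam = EBO ∧
        IsPrimitiveFor (ΦE * ΦJ) Hlam ∧
        IsPrimitiveFor (ΦE * ΦJ) EBO ∧
        -- the composite twisting element
        IsTwist (ΦBJ * ΦE * ΦJ))) ∧
    -- the configuration occurs in the types `B_N`, `C_N` and `F_4`
    ((∃ N : ℕ, 2 ≤ N ∧ (HasCartanMatrix H (CartanMatrix.B N) ∨
        HasCartanMatrix H (CartanMatrix.C N))) ∨ HasCartanMatrix H CartanMatrix.F₄ →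
      ∃ lam θ μ : LieModule.Weight K H L, IsCoincidentTriple lam θ μ) := by
  refine ⟨fun lam θ μ h => ?_, ?_⟩
  · have hls := h.isLongShort
    refine ⟨⟨?_, h.θ_root, h.constituent.root_sub, ?_⟩, hls.exists_isNormalized h.θ_eq,
      fun E P A B hn => ?_⟩
    · rw [h.θ_eq]; ext x
      simp only [Pi.add_apply, Pi.sub_apply, Pi.smul_apply, smul_eq_mul]; ring
    · convert h.lam_root using 1
      rw [h.θ_eq]; ext x
      simp only [Pi.add_apply, Pi.sub_apply, Pi.smul_apply, smul_eq_mul, two_nsmul]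
      ring
    · have hb := hls.isBorelExtension h.θ_eq hn
      exact ⟨hb.isTwist_extension, hb.η_deformed, hb.isPrimitiveFor_η, hb.isPrimitiveFor_deformed,
        hb.isTwist_composite⟩
  · rintro (⟨N, hN, hB | hC⟩ | hF)
    -- The double edge joins the last two nodes; `i` must be the long one, which is the next-to-last
    -- in type `B` and the last in type `C`.
    · refine exists_isCoincidentTriple_of_cartanMatrix hB (i := ⟨N - 2, by omega⟩)
        (j := ⟨N - 1, by omega⟩) ?_ ?_
      · simp only [CartanMatrix.B, Matrix.of_apply, Fin.mk.injEq]
        rw [if_neg (by omega), if_pos (by omega), if_pos trivial]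
      · simp only [CartanMatrix.B, Matrix.of_apply, Fin.mk.injEq]
        rw [if_neg (by omega), if_neg (by omega), if_pos (by omega)]
    · refine exists_isCoincidentTriple_of_cartanMatrix hC (i := ⟨N - 1, by omega⟩)
        (j := ⟨N - 2, by omega⟩) ?_ ?_
      · simp only [CartanMatrix.C, Matrix.of_apply, Fin.mk.injEq]
        rw [if_neg (by omega), if_neg (by omega), if_pos (by omega), if_pos trivial]
      · simp only [CartanMatrix.C, Matrix.of_apply, Fin.mk.injEq]
        rw [if_neg (by omega), if_pos (by omega)]
    · exact exists_isCoincidentTriple_of_cartanMatrix hF (i := 1) (j := 2) (by decide)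
        (by decide)
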